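/- **Theorem (Continuity of outward normal cones).** There is an absolute constant $C>0$ with the following property. Let $n,d\ge 0$ be integers, let $\tau,R,\Lambda>0$, and let $M\subset\mathbb R^n$ be a $d$-dimensional embedded $C^{2,1}$ submanifold without boundary that is closed as a subset of $\mathbb R^n$, such that 1. $\mathrm{reach}(M)\ge\tau$, where $\mathrm{reach}(M)\in[0,\infty]$ is the supremum of all $r\ge 0$ such that every $x\in\mathbb R^n$ with $\mathrm{dist}(x,M)\le r$ has a unique nearest point in $M$; 2. $M$ is $R$-exposed: for every $p\in M$ there is a closed ball $B\subset\mathbb R^n$ of radius $R$ with $M\subset B$ and $p\in\partial B$; 3. the second fundamental form of $M$ is $\Lambda$-Lipschitz: $\|\mathrm{II}_x-\mathrm{II}_y\|\le\Lambda\|x-y\|$ for all $x,y\in M$, where $\mathrm{II}_x$ is extended to a bilinear map $\mathbb R^n\times\mathbb R^n\to\mathbb R^n$ by precomposing both arguments with the orthogonal projection onto $T_xM$, and the norm on the left is the operator norm. Let $K=\mathrm{conv}(M)$ and, for $p\in M$, let $N_K(p)=\{v\in\mathbb R^n:\langle v,x-p\rangle\le 0\ \text{for all } x\in K\}$ be the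 outward normal cone. For cones $K_1,K_2\subset\mathbb R^n$ let $d_{CH}(K_1,K_2)$ be the Hausdorff distance between $K_1\cap B_1(0)$ and $K_2\cap B_1(0)$, where $B_1(0)$ is the closed unit ball. Then for all $x,y\in M$ $$ d_{CH}(N_K(x),N_K(y))\le L\,\|x-y\|,\qquad L=C R\,(\Lambda+\tau^{-2}). $$ -/

import Mathlib

noncomputable section

namespace ExposedManifold

/-- A map is of class `C^{2,1}` on the open set `V`: it is twice continuously differentiable
there and its second derivative is locally Lipschitz. -/
def IsC21On {F G : Type*} [NormedAddCommGroup F] [NormedSpace ℝ F]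
    [NormedAddCommGroup G] [NormedSpace ℝ G] (f : F → G) (V : Set F) : Prop :=
  ContDiffOn ℝ 2 f V ∧ LocallyLipschitzOn V (fderiv ℝ (fderiv ℝ f))

/-- `M` is an (embedded, boundaryless) `d`-dimensional `C^{2,1}` submanifold of `ℝⁿ`: every point
has an open neighbourhood `U` such that `M ∩ U` is the image of an open set `V ⊆ ℝᵈ` under
a `C^{2,1}` immersion `φ` which is a homeomorphism from `V` onto `M ∩ U` (with inverse `ψ`). -/
def IsC21Submanifold {n : ℕ} (d : ℕ) (M : Set (EuclideanSpace ℝ (Fin n))) : Prop :=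
  ∀ p ∈ M, ∃ (U : Set (EuclideanSpace ℝ (Fin n))) (V : Set (EuclideanSpace ℝ (Fin d)))
    (φ : EuclideanSpace ℝ (Fin d) → EuclideanSpace ℝ (Fin n))
    (ψ : EuclideanSpace ℝ (Fin n) → EuclideanSpace ℝ (Fin d)),
    IsOpen U ∧ p ∈ U ∧ IsOpen V ∧ IsC21On φ V ∧
      (∀ x ∈ V, Function.Injective (fderiv ℝ φ x)) ∧
      φ '' V = M ∩ U ∧ Set.LeftInvOn ψ φ V ∧ ContinuousOn ψ (M ∩ U)

/-- The reach of a closed set `A`: the supremum (possibly `∞`) of all `r ≥ 0` such that every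
point at distance at most `r` from `A` has a unique nearest point in `A`. -/
def reach {n : ℕ} (A : Set (EuclideanSpace ℝ (Fin n))) : ENNReal :=
  ⨆ (r : NNReal) (_ : ∀ x, Metric.infDist x A ≤ r → ∃! q, q ∈ A ∧ dist x q = Metric.infDist x A),
    (r : ENNReal)

/-- `M` is `R`-exposed: every point of `M` lies on the boundary of some closed ball of radius `R`
that contains `M`. -/
def IsExposed {n : ℕ} (R : ℝ) (M : Set (EuclideanSpace ℝ (Fin n))) : Prop :=
  ∀ p ∈ M, ∃ z, M ⊆ Metric.closedBall z R ∧ p ∈ Metric.sphere z R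

/-- The tangent space `T_p M` as a linear subspace of `ℝⁿ`. For a submanifold, the set of tangent
vectors `tangentConeAt ℝ M p` is already a linear subspace; the span only bundles it. -/
def tangentSpace {n : ℕ} (M : Set (EuclideanSpace ℝ (Fin n))) (p : EuclideanSpace ℝ (Fin n)) :
    Submodule ℝ (EuclideanSpace ℝ (Fin n)) :=
  Submodule.span ℝ (tangentConeAt ℝ M p)

/-- The orthogonal projection of `ℝⁿ` onto `T_p M`. -/
def tangentProj {n : ℕ} (M : Set (EuclideanSpace ℝ (Fin n))) (p : EuclideanSpace ℝ (Fin n)) :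
    EuclideanSpace ℝ (Fin n) →L[ℝ] EuclideanSpace ℝ (Fin n) :=
  (tangentSpace M p).starProjection

/-- The orthogonal projection of `ℝⁿ` onto the normal space `(T_p M)ᗮ`. -/
def normalProj {n : ℕ} (M : Set (EuclideanSpace ℝ (Fin n))) (p : EuclideanSpace ℝ (Fin n)) :
    EuclideanSpace ℝ (Fin n) →L[ℝ] EuclideanSpace ℝ (Fin n) :=
  (tangentSpace M p)ᗮ.starProjection

/-- The second fundamental form of `M` at `p`, extended to `ℝⁿ × ℝⁿ` through the tangential
projection. For tangent vectors `v, w` at `p` it is the normal component of the derivative at `p`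
along `v` of the tangent vector field `q ↦ Π_{T_q M} w`, whose value at `p` is `w`. The derivative
is taken within `M`, where it is only evaluated on tangent vectors, so that it is determined
by `M`. See `secondFundamentalForm_apply`. -/
def secondFundamentalForm {n : ℕ} (M : Set (EuclideanSpace ℝ (Fin n)))
    (p : EuclideanSpace ℝ (Fin n)) :
    EuclideanSpace ℝ (Fin n) →L[ℝ] EuclideanSpace ℝ (Fin n) →L[ℝ] EuclideanSpace ℝ (Fin n) :=
  (ContinuousLinearMap.compL ℝ _ _ _ (normalProj M p)).comp
    (((ContinuousLinearMap.compL ℝ _ _ _).flip (tangentProj M p)).comp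
      ((fderivWithin ℝ (tangentProj M) M p).comp (tangentProj M p)))

theorem secondFundamentalForm_apply {n : ℕ} (M : Set (EuclideanSpace ℝ (Fin n)))
    (p v w : EuclideanSpace ℝ (Fin n)) :
    secondFundamentalForm M p v w =
      normalProj M p
        (fderivWithin ℝ (tangentProj M) M p (tangentProj M p v) (tangentProj M p w)) :=
  rfl

/-- The second fundamental form of `M` is `Λ`-Lipschitz with respect to the operator norm. -/
def HasLipschitzSecondFundamentalForm {n : ℕ} (Λ : ℝ) (M : Set (EuclideanSpace ℝ (Fin n))) :
    Prop :=
  ∀ x ∈ M, ∀ y ∈ M,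
    ‖secondFundamentalForm M x - secondFundamentalForm M y‖ ≤ Λ * ‖x - y‖

/-- The outward normal cone of the convex set `K` at `p`. -/
def normalCone {n : ℕ} (K : Set (EuclideanSpace ℝ (Fin n))) (p : EuclideanSpace ℝ (Fin n)) :
    Set (EuclideanSpace ℝ (Fin n)) :=
  {v | ∀ x ∈ K, inner ℝ v (x - p) ≤ 0}

/-- The distance between two cones: the Hausdorff distance of their intersections with the closed
unit ball. For cones, which contain `0`, these intersections are bounded and nonempty. -/
def coneDist {n : ℕ} (K₁ K₂ : Set (EuclideanSpace ℝ (Fin n))) : ℝ :=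
  Metric.hausdorffDist (K₁ ∩ Metric.closedBall 0 1) (K₂ ∩ Metric.closedBall 0 1)

end ExposedManifold

end

/-! Write `k = τ⁻¹`, `P_p` for the tangential projection at `p`, and `ε = ‖x - y‖`. Let `v` be an
outward normal at `x` with `‖v‖ ≤ 1`. Its height function on `M` is maximal at `x`, so `P_x v = 0`.
An outward normal at `y` close to `v` is needed; if `4kε > 1` the vector `0` serves. Otherwise the
normal part `v - P_y v` is within `4kε` of `v`, but its height above `y` may be positive on `M`. The
core estimate, `ReachGeometry.height_le`, bounds this height at `q` by `264 (Λ + k²) ε ‖q - y‖²`. A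
ball of radius `R` and centre `z` that contains `M` and touches it at `y` gives `⟪y - z, q - y⟫ ≤
-‖q - y‖² / 2`, so adding `528 (Λ + k²) ε (y - z)` produces an outward normal at `y`. The cost is
`O(R (Λ + k²) ε)`, which absorbs `4kε` because `kR ≥ 1`.

For the core estimate with `q` near `y`, move the base point along a path `β` in `M` from `y` to `x`
and carry `q` along as the nearest point `α` to the translate `q - y + β`. At the end of the path
the height of `α` above `β` is nonpositive by maximality. Along the way it changes slowly: the
leading terms in its derivative are both `⟪v, II_β(β', α - β)⟫`, with opposite signs, and cancel by
the symmetry of `II`. What remains is `O((Λ + k²) ε ‖q - y‖²)`, by the Lipschitz bound on `II`, the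
near-normality of `v` at `β`, and the normality of `q - y + β - α` at `α`.

The reach enters through Federer's argument: a ball tangent to `M` that avoids `M` can be enlarged
to radius `τ`. This yields quadratic bounds on normal heights, the bound `k` on `II`, and Lipschitz
nearest points. Projected segments then serve as paths in `M`; they are only Lipschitz, so right
slopes with `o(z - t)` errors replace derivatives. -/

namespace ExposedManifold

open Filter Topology Asymptotics Set
open scoped RealInnerProductSpace

/-! ### Differentiability of orthogonal projections; charts and tangent spaces. -/

section

/-- Taking adjoints, as a real continuous linear map. -/
noncomputable def adjointL (E F : Type*) [NormedAddCommGroup E] [InnerProductSpace ℝ E] [CompleteSpace E]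
    [NormedAddCommGroup F] [InnerProductSpace ℝ F] [CompleteSpace F] :
    (E →L[ℝ] F) →L[ℝ] (F →L[ℝ] E) :=
  LinearMap.mkContinuous
    { toFun := fun A => ContinuousLinearMap.adjoint A
      map_add' := fun A B => map_add _ A B
      map_smul' := fun c A => by simp } 1 (fun A => by simp)

section Projection

variable {E F : Type*} [NormedAddCommGroup E] [InnerProductSpace ℝ E] [FiniteDimensional ℝ E]
  [NormedAddCommGroup F] [InnerProductSpace ℝ F] [FiniteDimensional ℝ F]

theorem isUnit_adjoint_comp_self {A : E →L[ℝ] F} (hA : Function.Injective A) :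
    IsUnit (A.adjoint.comp A) := by
  have hinj : Function.Injective (A.adjoint.comp A) := by
    rw [injective_iff_map_eq_zero]
    intro x hx
    have h : ⟪A x, A x⟫ = 0 := by
      rw [← ContinuousLinearMap.adjoint_inner_left]
      change ⟪(A.adjoint.comp A) x, x⟫ = 0
      rw [hx, inner_zero_left]
    exact (injective_iff_map_eq_zero A).1 hA x (inner_self_eq_zero.1 h)
  let e := (LinearEquiv.ofInjectiveEndo (A.adjoint.comp A).toLinearMap hinj).toContinuousLinearEquiv
  refine ⟨ContinuousLinearEquiv.toUnit e, ?_⟩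
  ext x
  rfl

/-- These are the normal equations of least squares. The formula makes the projection visibly
differentiable in `A`. -/
theorem starProjection_range_eq {A : E →L[ℝ] F} (hA : Function.Injective A) :
    (LinearMap.range A.toLinearMap).starProjection =
      A.comp ((Ring.inverse (A.adjoint.comp A)).comp A.adjoint) := by
  refine ContinuousLinearMap.ext fun v =>
    Submodule.eq_starProjection_of_mem_of_inner_eq_zero ?_ ?_
  · exact ⟨_, rfl⟩
  · rintro _ ⟨w, rfl⟩
    have h := Ring.mul_inverse_cancel _ (isUnit_adjoint_comp_self hA)
    have h2 := congrArg (fun T : E →L[ℝ] E => T (A.adjoint v)) h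
    simp only [ContinuousLinearMap.mul_def, ContinuousLinearMap.comp_apply,
      one_apply_eq_self] at h2
    change ⟪v - A (Ring.inverse (A.adjoint.comp A) (A.adjoint v)), A w⟫ = 0
    rw [← ContinuousLinearMap.adjoint_inner_left, map_sub, h2, sub_self, inner_zero_left]

theorem differentiableAt_starProjection_range {G : Type*} [NormedAddCommGroup G] [NormedSpace ℝ G]
    {A : G → E →L[ℝ] F} {a : G} (hA : DifferentiableAt ℝ A a)
    (hinj : ∀ᶠ b in 𝓝 a, Function.Injective (A b)) :
    DifferentiableAt ℝ (fun b => (LinearMap.range (A b).toLinearMap).starProjection) a := by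
  have h : DifferentiableAt ℝ (fun b => (A b).comp
      ((Ring.inverse ((adjointL E F (A b)).comp (A b))).comp (adjointL E F (A b)))) a := by
    have h1 : DifferentiableAt ℝ (fun b => adjointL E F (A b)) a :=
      (adjointL E F).differentiableAt.comp a hA
    have h2 := h1.clm_comp hA
    have h3 : DifferentiableAt ℝ Ring.inverse ((adjointL E F (A a)).comp (A a)) := by
      obtain ⟨u, hu⟩ := isUnit_adjoint_comp_self hinj.self_of_nhds
      have := (hasFDerivAt_ringInverse (𝕜 := ℝ) u).differentiableAt
      rw [hu] at this
      exact this
    exact hA.clm_comp ((h3.comp a h2).clm_comp h1)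
  refine h.congr_of_eventuallyEq ?_
  filter_upwards [hinj] with b hb
  exact starProjection_range_eq hb

end Projection

variable {n d : ℕ} {M : Set (EuclideanSpace ℝ (Fin n))}

/-- `φ` is a twice differentiable local parametrization of `M` with inverse `ψ`,
with `φ a = p`. -/
structure IsChart (M : Set (EuclideanSpace ℝ (Fin n))) (p : EuclideanSpace ℝ (Fin n))
    (φ : EuclideanSpace ℝ (Fin d) → EuclideanSpace ℝ (Fin n))
    (ψ : EuclideanSpace ℝ (Fin n) → EuclideanSpace ℝ (Fin d))
    (a : EuclideanSpace ℝ (Fin d)) : Prop where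
  map_base : φ a = p
  mem : ∀ᶠ b in 𝓝 a, φ b ∈ M
  hasFDerivAt : ∀ᶠ b in 𝓝 a, HasFDerivAt φ (fderiv ℝ φ b) b
  differentiableAt_fderiv : DifferentiableAt ℝ (fderiv ℝ φ) a
  injective : Function.Injective (fderiv ℝ φ a)
  tendsto : Tendsto ψ (𝓝[M] p) (𝓝 a)
  right_inv : ∀ᶠ q in 𝓝[M] p, φ (ψ q) = q

/-- One parametrization serves all nearby base points, because identities between tangent spaces at
`φ b` are later differentiated in `b`. -/
theorem IsC21Submanifold.exists_chart (hM : IsC21Submanifold d M) {p : EuclideanSpace ℝ (Fin n)}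
    (hp : p ∈ M) :
    ∃ (φ : EuclideanSpace ℝ (Fin d) → EuclideanSpace ℝ (Fin n))
      (ψ : EuclideanSpace ℝ (Fin n) → EuclideanSpace ℝ (Fin d)) (a : EuclideanSpace ℝ (Fin d)),
      IsChart M p φ ψ a ∧ ∀ᶠ b in 𝓝 a, IsChart M (φ b) φ ψ b := by
  obtain ⟨U, V, φ, ψ, hU, hpU, hV, ⟨hφ, -⟩, hinj, himg, hleft, hψ⟩ := hM p hp
  have key : ∀ b ∈ V, IsChart M (φ b) φ ψ b := by
    intro b hb
    have hbM : φ b ∈ M ∩ U := himg ▸ mem_image_of_mem φ hb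
    have hVb : V ∈ 𝓝 b := hV.mem_nhds hb
    have hnhds : 𝓝[M ∩ U] (φ b) = 𝓝[M] (φ b) := by
      rw [inter_comm]; exact nhdsWithin_inter_of_mem (mem_nhdsWithin_of_mem_nhds (hU.mem_nhds hbM.2))
    refine ⟨rfl, ?_, ?_, ?_, hinj b hb, ?_, ?_⟩
    · filter_upwards [hVb] with c hc
      exact (himg ▸ mem_image_of_mem φ hc : φ c ∈ M ∩ U).1
    · filter_upwards [hVb] with c hc
      exact ((hφ.differentiableOn (by norm_num)).differentiableAt (hV.mem_nhds hc)).hasFDerivAt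
    · have : ContDiffOn ℝ 1 (fderiv ℝ φ) V := hφ.fderiv_of_isOpen hV (by norm_num)
      exact (this.differentiableOn (by norm_num)).differentiableAt hVb
    · have := hψ (φ b) hbM
      rw [ContinuousWithinAt, hleft hb, hnhds] at this
      exact this
    · rw [← hnhds]
      filter_upwards [self_mem_nhdsWithin] with q hq
      rw [← himg] at hq
      obtain ⟨c, hc, rfl⟩ := hq
      rw [hleft hc]
  have hpMU : p ∈ M ∩ U := ⟨hp, hpU⟩
  rw [← himg] at hpMU
  obtain ⟨a, ha, rfl⟩ := hpMU
  exact ⟨φ, ψ, a, key a ha, eventually_of_mem (hV.mem_nhds ha) key⟩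

namespace IsChart

variable {p : EuclideanSpace ℝ (Fin n)} {φ : EuclideanSpace ℝ (Fin d) → EuclideanSpace ℝ (Fin n)}
  {ψ : EuclideanSpace ℝ (Fin n) → EuclideanSpace ℝ (Fin d)} {a : EuclideanSpace ℝ (Fin d)}

theorem hasFDerivAt_base (h : IsChart M p φ ψ a) : HasFDerivAt φ (fderiv ℝ φ a) a :=
  h.hasFDerivAt.self_of_nhds

/-- An injective linear map in finite dimension is bounded below, so `φ b - φ a` is of the exact
order of `b - a`. -/
theorem isBigO_inverse (h : IsChart M p φ ψ a) :
    (fun q => ψ q - a) =O[𝓝[M] p] fun q => q - p := by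
  obtain ⟨K, -, hK⟩ := LinearMap.exists_antilipschitzWith (fderiv ℝ φ a).toLinearMap
    (LinearMap.ker_eq_bot.2 h.injective)
  have h1 := (h.hasFDerivAt_base.isTheta_sub
    (hK.isInducing (fderiv ℝ φ a).continuous)).isBigO_symm.comp_tendsto h.tendsto
  refine h1.congr' EventuallyEq.rfl ?_
  filter_upwards [h.right_inv] with q hq
  simp [hq, h.map_base]

/-- Any left inverse of the derivative of `φ` serves as a derivative of `ψ` within `M`. -/
theorem differentiableWithinAt_inverse (h : IsChart M p φ ψ a) :
    DifferentiableWithinAt ℝ ψ M p := by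
  obtain ⟨S, hS⟩ := ContinuousLinearMap.HasLeftInverse.of_injective_of_finiteDimensional
    h.injective
  have hψp : ψ p = a := by
    have h0 : p ∈ M := h.map_base ▸ h.mem.self_of_nhds
    exact tendsto_nhds_unique ((tendsto_pure_nhds ψ p).mono_left (le_refl _))
      (h.tendsto.mono_left (pure_le_nhdsWithin h0))
  refine ⟨S, .of_isLittleO ?_⟩
  have h1 := ((h.hasFDerivAt_base.isLittleO).comp_tendsto h.tendsto).trans_isBigO h.isBigO_inverse
  refine ((S.isBigO_comp _ _).trans_isLittleO h1).neg_left.congr' ?_ EventuallyEq.rfl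
  filter_upwards [h.right_inv] with q hq
  simp [hq, h.map_base, hψp, hS (ψ q), hS a]

/-- A function that is differentiable along a chart is differentiable within `M`. -/
theorem differentiableWithinAt (h : IsChart M p φ ψ a) {G : Type*} [NormedAddCommGroup G]
    [NormedSpace ℝ G] {f : EuclideanSpace ℝ (Fin n) → G}
    (hf : DifferentiableAt ℝ (f ∘ φ) a) : DifferentiableWithinAt ℝ f M p := by
  have h0 : p ∈ M := h.map_base ▸ h.mem.self_of_nhds
  have hψp : ψ p = a :=
    tendsto_nhds_unique (tendsto_pure_nhds ψ p)
      (h.tendsto.mono_left (pure_le_nhdsWithin h0))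
  rw [← hψp] at hf
  refine (hf.comp_differentiableWithinAt p h.differentiableWithinAt_inverse).congr_of_eventuallyEq
    ?_ ?_
  · filter_upwards [h.right_inv] with q hq
    simp [hq]
  · simp [hψp, h.map_base]

theorem isLittleO_inner (h : IsChart M p φ ψ a) {v : EuclideanSpace ℝ (Fin n)}
    (hv : ∀ ξ, ⟪v, fderiv ℝ φ a ξ⟫ = 0) :
    (fun q => ⟪v, q - p⟫) =o[𝓝[M] p] fun q => q - p := by
  have h1 := ((h.hasFDerivAt_base.isLittleO).comp_tendsto h.tendsto).trans_isBigO h.isBigO_inverse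
  refine (((innerSL ℝ v).isBigO_comp _ _).trans_isLittleO h1).congr' ?_ EventuallyEq.rfl
  filter_upwards [h.right_inv] with q hq
  simp only [Function.comp, hq, h.map_base, innerSL_apply_apply]
  rw [inner_sub_right, hv, sub_zero]

/-- If `v` is orthogonal to the range, its height function has derivative `0` within `M` and also
`⟪v, ·⟫`; these agree on the tangent cone, so tangent vectors lie in the double orthogonal
complement. Conversely `φ` maps tangent cones to tangent cones. -/
theorem tangentSpace_eq (h : IsChart M p φ ψ a) :
    tangentSpace M p = LinearMap.range (fderiv ℝ φ a).toLinearMap := by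
  apply le_antisymm
  · refine Submodule.span_le.2 fun w hw => ?_
    rw [SetLike.mem_coe, ← Submodule.orthogonal_orthogonal (LinearMap.range _),
      Submodule.mem_orthogonal]
    intro v hv
    have hv' : ∀ ξ, ⟪v, fderiv ℝ φ a ξ⟫ = 0 := fun ξ =>
      (Submodule.mem_orthogonal' _ _).1 hv _ ⟨ξ, rfl⟩
    have h1 : HasFDerivWithinAt (fun q => ⟪v, q - p⟫)
        (0 : EuclideanSpace ℝ (Fin n) →L[ℝ] ℝ) M p :=
      .of_isLittleO (by simpa using h.isLittleO_inner hv')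
    have h2 : HasFDerivWithinAt (fun q => ⟪v, q - p⟫) (innerSL ℝ v) M p := by
      exact ((innerSL ℝ v).hasFDerivAt.comp p ((hasFDerivAt_id p).sub_const p)).hasFDerivWithinAt
    simpa using (h1.unique_on h2 hw).symm
  · rintro _ ⟨ξ, rfl⟩
    refine Submodule.subset_span ?_
    obtain ⟨V, hV, hVo, haV⟩ := mem_nhds_iff.1 h.mem
    have h1 := h.hasFDerivAt_base.hasFDerivWithinAt (s := V)
    have h2 := h1.mapsTo_tangent_cone (show ξ ∈ tangentConeAt ℝ V a by
      rw [tangentConeAt_of_mem_nhds (hVo.mem_nhds haV)]; trivial)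
    rw [h.map_base] at h2
    exact tangentConeAt_mono (image_subset_iff.2 hV) h2

theorem fderiv_mem_tangentSpace (h : IsChart M p φ ψ a) (ξ : EuclideanSpace ℝ (Fin d)) :
    fderiv ℝ φ a ξ ∈ tangentSpace M p := by
  rw [h.tangentSpace_eq]; exact ⟨ξ, rfl⟩

theorem eventually_injective (h : IsChart M p φ ψ a) :
    ∀ᶠ b in 𝓝 a, Function.Injective (fderiv ℝ φ b) :=
  h.differentiableAt_fderiv.continuousAt.eventually
    (ContinuousLinearMap.isOpen_injective.mem_nhds h.injective)

/-- A linear functional that vanishes on the tangent space vanishes to second order on `M`. -/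
theorem isBigO_inner (h : IsChart M p φ ψ a) {v : EuclideanSpace ℝ (Fin n)}
    (hv : ∀ ξ, ⟪v, fderiv ℝ φ a ξ⟫ = 0) :
    (fun q => ⟪v, q - p⟫) =O[𝓝[M] p] fun q => ‖q - p‖ ^ 2 := by
  -- Second-order Taylor bound, from the mean value inequality on the ball of radius `‖b - a‖`,
  -- where the derivative varies by at most `K * ‖b - a‖`.
  have h1 : (fun b => φ b - φ a - fderiv ℝ φ a (b - a)) =O[𝓝 a] fun b => ‖b - a‖ ^ 2 := by
    obtain ⟨K, hK⟩ := h.differentiableAt_fderiv.isBigO_sub.bound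
    obtain ⟨δ, hδ, hball⟩ := Metric.eventually_nhds_iff.1 (hK.and h.hasFDerivAt)
    refine IsBigO.of_bound K ?_
    filter_upwards [Metric.ball_mem_nhds a hδ] with b hb
    have hsub : ∀ c ∈ Metric.closedBall a ‖b - a‖, dist c a < δ := fun c hc =>
      (Metric.mem_closedBall.1 hc).trans_lt (by rwa [← dist_eq_norm])
    have hK0 : b ≠ a → 0 ≤ K := fun hne => by
      have := (norm_nonneg _).trans (hball (Metric.mem_ball.1 hb)).1
      exact nonneg_of_mul_nonneg_left this (norm_pos_iff.2 (sub_ne_zero.2 hne))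
    rcases eq_or_ne b a with rfl | hne
    · simp
    have := (convex_closedBall a ‖b - a‖).norm_image_sub_le_of_norm_hasFDerivWithin_le'
      (f := φ) (f' := fderiv ℝ φ) (φ := fderiv ℝ φ a) (C := K * ‖b - a‖)
      (fun c hc => (hball (hsub c hc)).2.hasFDerivWithinAt)
      (fun c hc => (hball (hsub c hc)).1.trans (mul_le_mul_of_nonneg_left
        (by simpa [dist_eq_norm] using hc) (hK0 hne)))
      (x := a) (y := b) (Metric.mem_closedBall_self (norm_nonneg _))
      (by simp [dist_eq_norm])
    simpa [pow_two, mul_assoc] using this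
  have h2 := (h1.comp_tendsto h.tendsto).trans (h.isBigO_inverse.norm_norm.pow 2)
  refine (((innerSL ℝ v).isBigO_comp _ _).trans h2).congr' ?_ EventuallyEq.rfl
  filter_upwards [h.right_inv] with q hq
  simp only [Function.comp, hq, h.map_base, innerSL_apply_apply]
  rw [inner_sub_right, hv, sub_zero]

/-- The derivative of a function vanishes in the tangent directions at a minimum on `M`. -/
theorem fderiv_eq_zero_of_isMinOn (h : IsChart M p φ ψ a) {f : EuclideanSpace ℝ (Fin n) → ℝ}
    {f' : EuclideanSpace ℝ (Fin n) →L[ℝ] ℝ} (hf : HasFDerivAt f f' p) (hmin : IsMinOn f M p)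
    {w : EuclideanSpace ℝ (Fin n)} (hw : w ∈ tangentSpace M p) : f' w = 0 := by
  rw [h.tangentSpace_eq] at hw
  obtain ⟨ξ, rfl⟩ := hw
  rw [← h.map_base] at hf
  have h1 := hf.comp a h.hasFDerivAt_base
  have h2 : IsLocalMin (f ∘ φ) a := by
    filter_upwards [h.mem] with b hb
    simpa [h.map_base] using hmin hb
  have h3 := h2.hasFDerivAt_eq_zero h1
  exact congrArg (fun T : EuclideanSpace ℝ (Fin d) →L[ℝ] ℝ => T ξ) h3

end IsChart

end

/-! ### The second fundamental form and the derivative of the tangential projection. -/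

section

variable {n d : ℕ} {M : Set (EuclideanSpace ℝ (Fin n))}
  {p : EuclideanSpace ℝ (Fin n)}

theorem tangentProj_idem (M : Set (EuclideanSpace ℝ (Fin n))) (p u : EuclideanSpace ℝ (Fin n)) :
    tangentProj M p (tangentProj M p u) = tangentProj M p u :=
  Submodule.starProjection_eq_self_iff.2 (Submodule.starProjection_apply_mem _ _)

theorem inner_tangentProj (M : Set (EuclideanSpace ℝ (Fin n)))
    (p u v : EuclideanSpace ℝ (Fin n)) :
    ⟪tangentProj M p u, v⟫ = ⟪u, tangentProj M p v⟫ :=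
  Submodule.inner_starProjection_left_eq_right _ _ _

theorem norm_tangentProj_le (M : Set (EuclideanSpace ℝ (Fin n)))
    (p u : EuclideanSpace ℝ (Fin n)) : ‖tangentProj M p u‖ ≤ ‖u‖ :=
  Submodule.norm_starProjection_apply_le _ _

theorem normalProj_apply (M : Set (EuclideanSpace ℝ (Fin n)))
    (p u : EuclideanSpace ℝ (Fin n)) : normalProj M p u = u - tangentProj M p u :=
  Submodule.starProjection_orthogonal_val _

theorem norm_sub_tangentProj_le (M : Set (EuclideanSpace ℝ (Fin n)))
    (p u : EuclideanSpace ℝ (Fin n)) : ‖u - tangentProj M p u‖ ≤ ‖u‖ := by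
  rw [← normalProj_apply]
  exact Submodule.norm_starProjection_apply_le _ _

theorem tangentProj_sub_self (M : Set (EuclideanSpace ℝ (Fin n)))
    (p u : EuclideanSpace ℝ (Fin n)) : tangentProj M p (u - tangentProj M p u) = 0 := by
  rw [map_sub, tangentProj_idem, sub_self]

theorem tangentProj_eq_zero_iff {v : EuclideanSpace ℝ (Fin n)} :
    tangentProj M p v = 0 ↔ v ∈ (tangentSpace M p)ᗮ :=
  Submodule.starProjection_apply_eq_zero_iff _

theorem secondFundamentalForm_tangentProj (u w : EuclideanSpace ℝ (Fin n)) :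
    secondFundamentalForm M p w (tangentProj M p u) = secondFundamentalForm M p w u := by
  simp only [secondFundamentalForm_apply, tangentProj_idem]

theorem tangentProj_secondFundamentalForm (u w : EuclideanSpace ℝ (Fin n)) :
    tangentProj M p (secondFundamentalForm M p w u) = 0 := by
  rw [secondFundamentalForm_apply, normalProj_apply, tangentProj_sub_self]

/-- The derivative of the tangential projection, extended by zero to normal directions. -/
noncomputable def derivTangentProj (M : Set (EuclideanSpace ℝ (Fin n)))
    (p : EuclideanSpace ℝ (Fin n)) :
    EuclideanSpace ℝ (Fin n) →L[ℝ] EuclideanSpace ℝ (Fin n) →L[ℝ] EuclideanSpace ℝ (Fin n) :=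
  (fderivWithin ℝ (tangentProj M) M p).comp (tangentProj M p)

theorem IsC21Submanifold.differentiableWithinAt_tangentProj (hM : IsC21Submanifold d M)
    (hp : p ∈ M) : DifferentiableWithinAt ℝ (tangentProj M) M p := by
  obtain ⟨φ, ψ, a, h, hev⟩ := hM.exists_chart hp
  refine h.differentiableWithinAt
    ((differentiableAt_starProjection_range h.differentiableAt_fderiv
      h.eventually_injective).congr_of_eventuallyEq ?_)
  filter_upwards [hev] with b hb
  simp only [Function.comp, tangentProj]
  congr 1
  exact hb.tangentSpace_eq

theorem IsChart.hasFDerivAt_tangentProj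
    {φ : EuclideanSpace ℝ (Fin d) → EuclideanSpace ℝ (Fin n)}
    {ψ : EuclideanSpace ℝ (Fin n) → EuclideanSpace ℝ (Fin d)} {a : EuclideanSpace ℝ (Fin d)}
    (h : IsChart M p φ ψ a) (hd : DifferentiableWithinAt ℝ (tangentProj M) M p) :
    HasFDerivAt (fun b => tangentProj M (φ b))
      ((fderivWithin ℝ (tangentProj M) M p).comp (fderiv ℝ φ a)) a := by
  exact hd.hasFDerivWithinAt.comp_hasFDerivAt_of_eq a h.hasFDerivAt_base h.mem h.map_base.symm

/-- Differentiate the identity that the projection at `φ b` fixes `fderiv ℝ φ b η`. -/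
theorem IsChart.fderivWithin_tangentProj_apply
    {φ : EuclideanSpace ℝ (Fin d) → EuclideanSpace ℝ (Fin n)}
    {ψ : EuclideanSpace ℝ (Fin n) → EuclideanSpace ℝ (Fin d)} {a : EuclideanSpace ℝ (Fin d)}
    (h : IsChart M p φ ψ a) (hev : ∀ᶠ b in 𝓝 a, IsChart M (φ b) φ ψ b)
    (hd : DifferentiableWithinAt ℝ (tangentProj M) M p) (ξ η : EuclideanSpace ℝ (Fin d)) :
    fderivWithin ℝ (tangentProj M) M p (fderiv ℝ φ a ξ) (fderiv ℝ φ a η) =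
      fderiv ℝ (fderiv ℝ φ) a ξ η - tangentProj M p (fderiv ℝ (fderiv ℝ φ) a ξ η) := by
  have h1 := h.hasFDerivAt_tangentProj hd
  have h2 : HasFDerivAt (fun b => fderiv ℝ φ b η) ((fderiv ℝ (fderiv ℝ φ) a).flip η) a :=
    h.differentiableAt_fderiv.hasFDerivAt.clm_apply (hasFDerivAt_const η a) |>.congr_fderiv
      (by ext; simp)
  have h3 := h1.clm_apply h2
  have h4 : HasFDerivAt (fun b => tangentProj M (φ b) (fderiv ℝ φ b η))
      ((fderiv ℝ (fderiv ℝ φ) a).flip η) a := by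
    refine h2.congr_of_eventuallyEq ?_
    filter_upwards [hev] with b hb
    exact Submodule.starProjection_eq_self_iff.2 (hb.fderiv_mem_tangentSpace η)
  have h5 := congrArg (fun T : EuclideanSpace ℝ (Fin d) →L[ℝ] EuclideanSpace ℝ (Fin n) => T ξ)
    (h3.unique h4)
  simp only [add_apply, ContinuousLinearMap.comp_apply,
    ContinuousLinearMap.flip_apply, h.map_base] at h5
  exact eq_sub_of_add_eq' h5

/-- This is the derivative of `P² = P`. The next lemma likewise differentiates the self-adjointness
of `P`. -/
theorem derivTangentProj_idem (hM : IsC21Submanifold d M) (hp : p ∈ M)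
    (w v : EuclideanSpace ℝ (Fin n)) :
    derivTangentProj M p w (tangentProj M p v) + tangentProj M p (derivTangentProj M p w v) =
      derivTangentProj M p w v := by
  obtain ⟨φ, ψ, a, h, hev⟩ := hM.exists_chart hp
  have h1 := h.hasFDerivAt_tangentProj (hM.differentiableWithinAt_tangentProj hp)
  have hw : tangentProj M p w ∈ tangentSpace M p := Submodule.starProjection_apply_mem _ _
  rw [h.tangentSpace_eq] at hw
  obtain ⟨ξ, hξ⟩ := hw
  have h2 := h1.clm_apply (hasFDerivAt_const v a)
  have h3 := h1.clm_apply h2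
  simp only [tangentProj_idem] at h3
  have h5 := congrArg (fun T : EuclideanSpace ℝ (Fin d) →L[ℝ] EuclideanSpace ℝ (Fin n) => T ξ)
    (h3.unique h2)
  have hξ' : fderiv ℝ φ a ξ = tangentProj M p w := hξ
  simp only [add_apply, ContinuousLinearMap.comp_apply,
    ContinuousLinearMap.flip_apply, h.map_base, zero_apply, map_zero, zero_add,
    hξ'] at h5
  rw [add_comm] at h5
  exact h5

theorem inner_derivTangentProj (hM : IsC21Submanifold d M) (hp : p ∈ M)
    (w u v : EuclideanSpace ℝ (Fin n)) :
    ⟪derivTangentProj M p w u, v⟫ = ⟪u, derivTangentProj M p w v⟫ := by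
  obtain ⟨φ, ψ, a, h, hev⟩ := hM.exists_chart hp
  have h1 := h.hasFDerivAt_tangentProj (hM.differentiableWithinAt_tangentProj hp)
  have hw : tangentProj M p w ∈ tangentSpace M p := Submodule.starProjection_apply_mem _ _
  rw [h.tangentSpace_eq] at hw
  obtain ⟨ξ, hξ⟩ := hw
  have hξ' : fderiv ℝ φ a ξ = tangentProj M p w := hξ
  have h2 := (h1.clm_apply (hasFDerivAt_const u a)).inner ℝ (hasFDerivAt_const v a)
  have h3 := (hasFDerivAt_const u a).inner ℝ (h1.clm_apply (hasFDerivAt_const v a))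
  simp only [inner_tangentProj] at h2
  have h5 := congrArg (fun T : EuclideanSpace ℝ (Fin d) →L[ℝ] ℝ => T ξ) (h2.unique h3)
  simpa [fderivInnerCLM_apply, hξ', derivTangentProj] using h5

/-- The derivative of the tangential projection in terms of the second fundamental form. -/
theorem inner_derivTangentProj_eq (hM : IsC21Submanifold d M) (hp : p ∈ M)
    (w u v : EuclideanSpace ℝ (Fin n)) :
    ⟪derivTangentProj M p w u, v⟫ =
      ⟪secondFundamentalForm M p w u, v⟫ + ⟪u, secondFundamentalForm M p w v⟫ := by
  -- Differentiating `P² = P` shows that the derivative of `P` maps tangent vectors to normal ones,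
  -- so the normal projection in the definition of the form is redundant.
  have key : ∀ u, secondFundamentalForm M p w u = derivTangentProj M p w (tangentProj M p u) := by
    intro u
    have h := derivTangentProj_idem hM hp w (tangentProj M p u)
    rw [tangentProj_idem, add_eq_left] at h
    rw [secondFundamentalForm_apply, normalProj_apply]
    change derivTangentProj M p w (tangentProj M p u) -
      tangentProj M p (derivTangentProj M p w (tangentProj M p u)) = _
    rw [h, sub_zero]
  rw [key, key, ← derivTangentProj_idem hM hp w u, inner_add_left, inner_tangentProj,
    inner_derivTangentProj hM hp w u]

theorem IsChart.secondFundamentalForm_apply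
    {φ : EuclideanSpace ℝ (Fin d) → EuclideanSpace ℝ (Fin n)}
    {ψ : EuclideanSpace ℝ (Fin n) → EuclideanSpace ℝ (Fin d)} {a : EuclideanSpace ℝ (Fin d)}
    (h : IsChart M p φ ψ a) (hev : ∀ᶠ b in 𝓝 a, IsChart M (φ b) φ ψ b)
    (hd : DifferentiableWithinAt ℝ (tangentProj M) M p) {ξ η : EuclideanSpace ℝ (Fin d)}
    {w u : EuclideanSpace ℝ (Fin n)} (hξ : fderiv ℝ φ a ξ = tangentProj M p w)
    (hη : fderiv ℝ φ a η = tangentProj M p u) :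
    secondFundamentalForm M p w u =
      fderiv ℝ (fderiv ℝ φ) a ξ η - tangentProj M p (fderiv ℝ (fderiv ℝ φ) a ξ η) := by
  rw [ExposedManifold.secondFundamentalForm_apply, ← hξ, ← hη,
    h.fderivWithin_tangentProj_apply hev hd, normalProj_apply, tangentProj_sub_self, sub_zero]

/-- In a chart the form is the normal part of the second derivative of `φ`, which is symmetric. -/
theorem secondFundamentalForm_symm (hM : IsC21Submanifold d M) (hp : p ∈ M)
    (w u : EuclideanSpace ℝ (Fin n)) :
    secondFundamentalForm M p w u = secondFundamentalForm M p u w := by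
  obtain ⟨φ, ψ, a, h, hev⟩ := hM.exists_chart hp
  have hd := hM.differentiableWithinAt_tangentProj hp
  have hT : ∀ w, ∃ ξ, fderiv ℝ φ a ξ = tangentProj M p w := fun w => by
    have hw : tangentProj M p w ∈ tangentSpace M p := Submodule.starProjection_apply_mem _ _
    rw [h.tangentSpace_eq] at hw
    exact hw
  obtain ⟨ξ, hξ⟩ := hT w
  obtain ⟨η, hη⟩ := hT u
  rw [h.secondFundamentalForm_apply hev hd hξ hη, h.secondFundamentalForm_apply hev hd hη hξ,
    second_derivative_symmetric_of_eventually h.hasFDerivAt h.differentiableAt_fderiv.hasFDerivAt]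

/-- The second derivative is nonnegative at a local minimum. -/
theorem deriv_deriv_nonneg_of_isLocalMin {f : ℝ → ℝ} {x : ℝ} (h : IsLocalMin f x)
    (hc : ContinuousAt f x) : 0 ≤ deriv (deriv f) x := by
  by_contra! hneg
  -- A negative second derivative would make `x` a local maximum too, hence `f` locally constant.
  have h1 := isLocalMax_of_deriv_deriv_neg hneg h.deriv_eq_zero hc
  have h2 : f =ᶠ[𝓝 x] fun _ => f x := by
    filter_upwards [h, h1] with y hy hy'
    exact le_antisymm hy' hy
  have h3 : deriv f =ᶠ[𝓝 x] fun _ => 0 := by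
    filter_upwards [h2.eventuallyEq_nhds] with y hy
    rw [hy.deriv_eq, deriv_const]
  rw [h3.deriv_eq, deriv_const] at hneg
  exact lt_irrefl _ hneg

/-- The acceleration of a curve that stays on one side of a paraboloid. -/
theorem inner_second_deriv_le {E : Type*} [NormedAddCommGroup E] [InnerProductSpace ℝ E]
    {γ γ' : ℝ → E} {γ'' v : E} {c : ℝ} (hγ : ∀ᶠ s in 𝓝 (0 : ℝ), HasDerivAt γ (γ' s) s)
    (hγ' : HasDerivAt γ' γ'' 0)
    (hc : ∀ᶠ s in 𝓝 (0 : ℝ), 2 * ⟪v, γ s - γ 0⟫ ≤ c * ‖γ s - γ 0‖ ^ 2) :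
    ⟪v, γ''⟫ ≤ c * ‖γ' 0‖ ^ 2 := by
  set p := γ 0 with hp
  have hG : ∀ᶠ s in 𝓝 (0 : ℝ), HasDerivAt (fun s => c * ⟪γ s - p, γ s - p⟫ - 2 * ⟪v, γ s - p⟫)
      (c * (2 * ⟪γ s - p, γ' s⟫) - 2 * ⟪v, γ' s⟫) s := by
    filter_upwards [hγ] with s hs
    have h0 := hs.sub_const p
    have h1 := (h0.inner ℝ h0).const_mul c
    have h2 := ((hasDerivAt_const s v).inner ℝ h0).const_mul 2
    refine (h1.fun_sub h2).congr_deriv ?_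
    rw [real_inner_comm (γ s - p), inner_zero_left]
    ring
  have hG2 : HasDerivAt (deriv (fun s => c * ⟪γ s - p, γ s - p⟫ - 2 * ⟪v, γ s - p⟫))
      (c * (2 * ‖γ' 0‖ ^ 2) - 2 * ⟪v, γ''⟫) 0 := by
    have h0 := hγ.self_of_nhds.sub_const p
    have h1 := ((h0.inner ℝ hγ').const_mul 2).const_mul c
    have h2 := ((hasDerivAt_const (0 : ℝ) v).inner ℝ hγ').const_mul 2
    refine ((h1.fun_sub h2).congr_deriv ?_).congr_of_eventuallyEq ?_
    · simp [← hp]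
    · filter_upwards [hG] with s hs
      rw [hs.deriv]
  have hmin : IsLocalMin (fun s => c * ⟪γ s - p, γ s - p⟫ - 2 * ⟪v, γ s - p⟫) 0 := by
    filter_upwards [hc] with s hs
    simp only [← hp, sub_self, inner_zero_right, real_inner_self_eq_norm_sq]
    linarith
  have := deriv_deriv_nonneg_of_isLocalMin hmin hG.self_of_nhds.continuousAt
  rw [hG2.deriv] at this
  linarith

/-- If `M` lies on one side of a paraboloid at `p`, its second fundamental form is bounded. -/
theorem inner_secondFundamentalForm_self_le (hM : IsC21Submanifold d M) (hp : p ∈ M)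
    {v : EuclideanSpace ℝ (Fin n)} (hv : tangentProj M p v = 0) {c : ℝ}
    (hc : ∀ q ∈ M, 2 * ⟪v, q - p⟫ ≤ c * ‖q - p‖ ^ 2) (w : EuclideanSpace ℝ (Fin n)) :
    ⟪v, secondFundamentalForm M p w w⟫ ≤ c * ‖tangentProj M p w‖ ^ 2 := by
  obtain ⟨φ, ψ, a, h, hev⟩ := hM.exists_chart hp
  have hd := hM.differentiableWithinAt_tangentProj hp
  have hw : tangentProj M p w ∈ tangentSpace M p := Submodule.starProjection_apply_mem _ _
  rw [h.tangentSpace_eq] at hw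
  obtain ⟨ξ, hξ⟩ := hw
  have hξ' : fderiv ℝ φ a ξ = tangentProj M p w := hξ
  rw [h.secondFundamentalForm_apply hev hd hξ' hξ', inner_sub_right, ← inner_tangentProj, hv,
    inner_zero_left, sub_zero, ← hξ']
  set γ : ℝ → EuclideanSpace ℝ (Fin n) := fun s => φ (a + s • ξ)
  have hline : ∀ s : ℝ, HasDerivAt (fun s : ℝ => a + s • ξ) ξ s := fun s => by
    simpa using ((hasDerivAt_id s).smul_const ξ).const_add a
  have htend : Tendsto (fun s : ℝ => a + s • ξ) (𝓝 0) (𝓝 a) := by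
    simpa using (hline 0).continuousAt.tendsto
  have hγ : ∀ᶠ s in 𝓝 (0 : ℝ), HasDerivAt γ (fderiv ℝ φ (a + s • ξ) ξ) s := by
    filter_upwards [htend.eventually h.hasFDerivAt] with s hs
    exact hs.comp_hasDerivAt s (hline s)
  have hγ0 : γ 0 = p := by simp [γ, h.map_base]
  have hγ' : HasDerivAt (fun s : ℝ => fderiv ℝ φ (a + s • ξ) ξ)
      (fderiv ℝ (fderiv ℝ φ) a ξ ξ) 0 := by
    have h1 : HasFDerivAt (fderiv ℝ φ) (fderiv ℝ (fderiv ℝ φ) a) (a + (0 : ℝ) • ξ) := by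
      simpa using h.differentiableAt_fderiv.hasFDerivAt
    have h2 := (ContinuousLinearMap.apply ℝ (EuclideanSpace ℝ (Fin n)) ξ).hasFDerivAt.comp_hasDerivAt
      (0 : ℝ) (h1.comp_hasDerivAt (0 : ℝ) (hline 0))
    exact h2
  have := inner_second_deriv_le hγ hγ' (v := v) (c := c) (by
    filter_upwards [htend.eventually h.mem] with s hs
    rw [hγ0]
    exact hc _ hs)
  simpa using this

/-- A symmetric bilinear form is bounded by its values on the diagonal. -/
theorem abs_le_of_abs_self_le {E : Type*} [NormedAddCommGroup E] [InnerProductSpace ℝ E]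
    {β : E →L[ℝ] E →L[ℝ] ℝ} (hβ : ∀ u w, β u w = β w u) {c : ℝ}
    (hc : ∀ w, |β w w| ≤ c * ‖w‖ ^ 2) (u w : E) : |β u w| ≤ c * ‖u‖ * ‖w‖ := by
  have key : ∀ u w, 2 * |β u w| ≤ c * (‖u‖ ^ 2 + ‖w‖ ^ 2) := by
    intro u w
    have h1 := hc (u + w)
    have h2 := hc (u - w)
    have h3 := parallelogram_law_with_norm ℝ u w
    have h4 : β (u + w) (u + w) - β (u - w) (u - w) = 4 * β u w := by
      simp only [map_add, map_sub, add_apply, sub_apply]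
      rw [hβ w u]; ring
    have h5 := abs_sub (β (u + w) (u + w)) (β (u - w) (u - w))
    rw [h4, abs_mul, abs_of_pos (by norm_num : (0 : ℝ) < 4)] at h5
    have h6 : c * ‖u + w‖ ^ 2 + c * ‖u - w‖ ^ 2 = 2 * (c * (‖u‖ ^ 2 + ‖w‖ ^ 2)) := by
      linear_combination c * h3
    linarith
  rcases eq_or_ne u 0 with rfl | hu
  · simp
  rcases eq_or_ne w 0 with rfl | hw
  · simp
  have hu' := norm_pos_iff.2 hu
  have hw' := norm_pos_iff.2 hw
  -- Rescaling to equal norms turns the arithmetic mean in `key` into the product of the norms.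
  have h := key (‖w‖ • u) (‖u‖ • w)
  simp only [map_smul, smul_apply, smul_eq_mul, abs_mul, abs_norm, norm_smul,
    norm_norm] at h
  have h7 : 0 < ‖w‖ * ‖u‖ := mul_pos hw' hu'
  refine le_of_mul_le_mul_left (a := 2 * (‖w‖ * ‖u‖)) ?_ (by positivity)
  linarith

/-- Only the normal part of `v` matters. The paraboloid bounds for `v` and `-v` control the diagonal
from both sides, and polarization does the rest. -/
theorem abs_inner_secondFundamentalForm_le (hM : IsC21Submanifold d M) (hp : p ∈ M) {k : ℝ}
    (hk : 0 ≤ k)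
    (h : ∀ v, tangentProj M p v = 0 → ∀ q ∈ M, 2 * ⟪v, q - p⟫ ≤ k * ‖v‖ * ‖q - p‖ ^ 2)
    (w u v : EuclideanSpace ℝ (Fin n)) :
    |⟪v, secondFundamentalForm M p w u⟫| ≤ k * ‖v‖ * ‖w‖ * ‖u‖ := by
  have key : ∀ v w, ⟪v, secondFundamentalForm M p w w⟫ ≤ k * ‖v‖ * ‖w‖ ^ 2 := by
    intro v w
    have h0 := tangentProj_sub_self M p v
    have h1 := inner_secondFundamentalForm_self_le hM hp h0 (h _ h0) w
    rw [inner_sub_left, inner_tangentProj, tangentProj_secondFundamentalForm, inner_zero_right,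
      sub_zero] at h1
    refine h1.trans ?_
    gcongr
    · exact norm_sub_tangentProj_le _ _ _
    · exact norm_tangentProj_le _ _ _
  refine abs_le_of_abs_self_le
    (β := (ContinuousLinearMap.compL ℝ _ _ _ (innerSL ℝ v)).comp (secondFundamentalForm M p))
    (fun u w => ?_) (fun w => ?_) w u
  · simp [secondFundamentalForm_symm hM hp u w]
  · have h1 := key (-v) w
    rw [inner_neg_left, norm_neg] at h1
    exact abs_le.2 ⟨by simpa using neg_le.1 h1, key v w⟩

end

/-! ### Unique nearest points, tangent balls and the nearest point map. -/

section

section Reach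

variable {E : Type*} [NormedAddCommGroup E] [InnerProductSpace ℝ E] [ProperSpace E] {M : Set E}
  {τ : ℝ}

/-- Moving away from a unique nearest point increases the distance at almost unit speed. -/
theorem exists_le_dist_of_unique_nearest (hM : IsClosed M) {b q u : E} {δ η : ℝ} (hδ : 0 < δ)
    (hη : 0 < η) (hη1 : η < 1) (hq : ∀ z ∈ M, δ ≤ dist b z)
    (huniq : ∀ z ∈ M, dist b z = δ → z = q) (hu : ‖u‖ = 1) (hb : b - q = δ • u) :
    ∃ h₀ > 0, ∀ h, 0 ≤ h → h ≤ h₀ → ∀ z ∈ M, δ + (1 - η) * h ≤ dist (b + h • u) z := by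
  obtain ⟨m, hm, hfar⟩ : ∃ m > δ, ∀ z ∈ M, η * δ ≤ dist z q → m ≤ dist b z := by
    set S := M ∩ {z | η * δ ≤ dist z q}
    rcases S.eq_empty_or_nonempty with hS | hS
    · refine ⟨δ + 1, by linarith, fun z hz hzq => ?_⟩
      have : z ∈ S := ⟨hz, hzq⟩
      simp [hS] at this
    · have hSc : IsClosed S :=
        hM.inter (isClosed_le continuous_const (continuous_id.dist continuous_const))
      obtain ⟨s, hs, hsd⟩ := hSc.exists_infDist_eq_dist hS b
      refine ⟨dist b s, lt_of_le_of_ne (hq s hs.1) ?_, fun z hz hzq => ?_⟩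
      · intro heq
        have := huniq s hs.1 heq.symm
        have h2 : η * δ ≤ dist s q := hs.2
        rw [this, dist_self] at h2
        exact absurd h2 (not_le.2 (mul_pos hη hδ))
      · rw [← hsd]
        exact Metric.infDist_le_dist_of_mem ⟨hz, hzq⟩
  refine ⟨(m - δ) / 2, by linarith, fun h h0 h1 z hz => ?_⟩
  rcases le_or_gt (η * δ) (dist z q) with hzq | hzq
  · have h2 := hfar z hz hzq
    have h3 : dist b z ≤ dist b (b + h • u) + dist (b + h • u) z := dist_triangle _ _ _
    rw [dist_self_add_right, norm_smul, hu, mul_one, Real.norm_of_nonneg h0] at h3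
    nlinarith
  · have h2 : ‖b - z + h • u‖ ^ 2 = ‖b - z‖ ^ 2 + 2 * (h * ⟪b - z, u⟫) + h ^ 2 := by
      rw [norm_add_sq_real, inner_smul_right, norm_smul, hu, mul_one, Real.norm_eq_abs, sq_abs]
    have h3 : ⟪b - z, u⟫ = δ + ⟪q - z, u⟫ := by
      rw [← sub_add_sub_cancel b q z, inner_add_left, hb, inner_smul_left,
        real_inner_self_eq_norm_sq, hu]
      simp
    have h4 : -(η * δ) ≤ ⟪q - z, u⟫ := by
      have := abs_real_inner_le_norm (q - z) u
      rw [hu, mul_one, ← dist_eq_norm, dist_comm] at this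
      linarith [(abs_le.1 this).1]
    have h5 : δ ^ 2 ≤ ‖b - z‖ ^ 2 := by
      rw [← dist_eq_norm]
      exact pow_le_pow_left₀ hδ.le (hq z hz) 2
    have h6 : h * (δ + -(η * δ)) ≤ h * ⟪b - z, u⟫ := by
      rw [h3]
      gcongr
    rw [dist_eq_norm, show b + h • u - z = b - z + h • u by abel]
    refine abs_le_of_sq_le_sq' ?_ (norm_nonneg _) |>.2
    nlinarith [mul_nonneg (sq_nonneg h) hη.le, mul_nonneg (mul_nonneg (sq_nonneg h) hη.le)
      (sub_nonneg.2 hη1.le)]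

/-- Every point at distance less than `τ` from `M` has a unique nearest point in `M`. -/
def HasUniqueNearest (τ : ℝ) (M : Set E) : Prop :=
  ∀ x, Metric.infDist x M < τ → ∃! q, q ∈ M ∧ dist x q = Metric.infDist x M

/-- Within the reach, a nearest point stays nearest along the normal ray. -/
theorem HasUniqueNearest.le_infDist_add (hU : HasUniqueNearest τ M) (hM : IsClosed M) {a p v : E}
    {δ s : ℝ} (hp : p ∈ M) (hδ : 0 < δ) (hs : 0 ≤ s) (hsτ : δ + s < τ) (hv : ‖v‖ = 1)
    (ha : a - p = δ • v) (hnear : ∀ z ∈ M, δ ≤ dist a z) :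
    δ + s ≤ Metric.infDist (a + s • v) M := by
  have hne : M.Nonempty := ⟨p, hp⟩
  have hap : dist a p = δ := by
    rw [dist_eq_norm, ha, norm_smul, hv, mul_one, Real.norm_of_nonneg hδ.le]
  have hcomp : IsCompact (Metric.closedBall a s) := isCompact_closedBall a s
  have hself : a ∈ Metric.closedBall a s := Metric.mem_closedBall_self hs
  have haM : δ ≤ Metric.infDist a M := (Metric.le_infDist hne).2 hnear
  -- Maximize `infDist - (1 - η) * dist · a` on the ball. At an interior maximum, moving away from
  -- the nearest point at speed `1 - η / 2` would increase it, so the maximum lies on the boundary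
  -- sphere.
  have key : ∀ η, 0 < η → η < 1 →
      ∃ b ∈ Metric.closedBall a s, δ + (1 - η) * s ≤ Metric.infDist b M := by
    intro η hη hη1
    obtain ⟨b, hb, hmax⟩ := hcomp.exists_isMaxOn ⟨a, hself⟩
      (f := fun b => Metric.infDist b M - (1 - η) * dist b a)
      ((Metric.continuous_infDist_pt M).sub
        (continuous_const.mul (continuous_id.dist continuous_const))).continuousOn
    refine ⟨b, hb, ?_⟩
    have h1 : δ + (1 - η) * dist b a ≤ Metric.infDist b M := by
      have := hmax hself
      simp only [mem_ofPred_eq, dist_self, mul_zero, sub_zero] at this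
      linarith
    rcases eq_or_lt_of_le (Metric.mem_closedBall.1 hb) with hbs | hbs
    · rwa [hbs] at h1
    exfalso
    have hbτ : Metric.infDist b M < τ := by
      have := Metric.infDist_le_infDist_add_dist (s := M) (x := b) (y := a)
      have h3 := Metric.infDist_le_dist_of_mem (x := a) hp
      linarith
    obtain ⟨q, ⟨hq, hbq⟩, huniq⟩ := hU b hbτ
    have hδb : 0 < Metric.infDist b M := by
      have : 0 ≤ (1 - η) * dist b a := mul_nonneg (by linarith) dist_nonneg
      linarith
    set D := Metric.infDist b M
    have hu : ‖D⁻¹ • (b - q)‖ = 1 := by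
      rw [norm_smul, ← dist_eq_norm, hbq, norm_inv, Real.norm_of_nonneg hδb.le,
        inv_mul_cancel₀ hδb.ne']
    obtain ⟨h₀, hh₀, hgrow⟩ := exists_le_dist_of_unique_nearest hM (b := b) (q := q)
      (u := D⁻¹ • (b - q)) hδb (half_pos hη) (by linarith)
      (fun z hz => Metric.infDist_le_dist_of_mem hz) (fun z hz hzd => huniq z ⟨hz, hzd⟩) hu
      (by rw [smul_smul, mul_inv_cancel₀ hδb.ne', one_smul])
    set u := D⁻¹ • (b - q)
    set h := min h₀ (s - dist b a)
    have hh : 0 < h := lt_min hh₀ (by linarith)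
    have h4 := (Metric.le_infDist hne).2 (hgrow h hh.le (min_le_left _ _))
    have h5 : dist (b + h • u) a ≤ h + dist b a := by
      refine (dist_triangle _ b _).trans ?_
      rw [dist_self_add_left, norm_smul, hu, mul_one, Real.norm_of_nonneg hh.le]
    have h6 := hmax (show b + h • u ∈ Metric.closedBall a s from
      Metric.mem_closedBall.2 (h5.trans (by linarith [min_le_right h₀ (s - dist b a)])))
    simp only [mem_ofPred_eq] at h6
    have h7 := mul_le_mul_of_nonneg_left h5 (by linarith : 0 ≤ 1 - η)
    nlinarith [mul_pos hη hh]
  -- The limit `η → 0`: a maximum of the distance to `M` dominates every bound in `key`.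
  obtain ⟨b, hb, hmax⟩ := hcomp.exists_isMaxOn ⟨a, hself⟩
    (Metric.continuous_infDist_pt M).continuousOn
  have hbd : δ + s ≤ Metric.infDist b M := by
    by_contra! hlt
    have hs0 : 0 < s := by
      rcases hs.eq_or_lt with h | h
      · have := hmax hself
        simp only [mem_ofPred_eq] at this
        linarith
      · exact h
    set e := δ + s - Metric.infDist b M
    have he : 0 < e := by simp only [e]; linarith
    obtain ⟨b', hb', h1⟩ := key (min (1 / 2) (e / (2 * s))) (by positivity)
      (lt_of_le_of_lt (min_le_left _ _) (by norm_num))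
    have h2 := hmax hb'
    simp only [mem_ofPred_eq] at h2
    have h3 : min (1 / 2) (e / (2 * s)) * s ≤ e / 2 := by
      refine (mul_le_mul_of_nonneg_right (min_le_right _ _) hs).trans (le_of_eq ?_)
      field_simp
    simp only [e] at h3 he
    nlinarith
  -- Since `‖b - a‖ ≤ s` and `‖a - p‖ = δ`, this is equality in the triangle inequality, which
  -- forces `b = a + s • v`.
  have hbp : δ + s ≤ ‖b - p‖ := by
    rw [← dist_eq_norm]
    exact hbd.trans (Metric.infDist_le_dist_of_mem hp)
  have hba : ‖b - a‖ ≤ s := by rw [← dist_eq_norm]; exact hb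
  have h1 : ‖b - p‖ ^ 2 = ‖b - a‖ ^ 2 + 2 * (δ * ⟪b - a, v⟫) + δ ^ 2 := by
    rw [← sub_add_sub_cancel b a p, norm_add_sq_real, ha, inner_smul_right, norm_smul, hv, mul_one,
      Real.norm_eq_abs, sq_abs]
  have h2 : ‖b - a - s • v‖ ^ 2 = ‖b - a‖ ^ 2 - 2 * (s * ⟪b - a, v⟫) + s ^ 2 := by
    rw [norm_sub_sq_real, inner_smul_right, norm_smul, hv, mul_one, Real.norm_eq_abs, sq_abs]
  have h3 : (δ + s) ^ 2 ≤ ‖b - p‖ ^ 2 := pow_le_pow_left₀ (by positivity) hbp 2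
  have h4 : ‖b - a‖ ^ 2 ≤ s ^ 2 := pow_le_pow_left₀ (norm_nonneg _) hba 2
  have h5 : s ≤ ⟪b - a, v⟫ := by
    have : δ * s ≤ δ * ⟪b - a, v⟫ := by nlinarith
    exact le_of_mul_le_mul_left this hδ
  have h6 : ‖b - a - s • v‖ ^ 2 ≤ 0 := by nlinarith
  have h7 : b = a + s • v := by
    have : ‖b - a - s • v‖ = 0 := by
      exact pow_eq_zero_iff (two_ne_zero) |>.1 (le_antisymm h6 (sq_nonneg _))
    have := norm_eq_zero.1 this
    rw [sub_sub, sub_eq_zero] at this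
    exact this
  rwa [← h7]

/-- A ball tangent to `M` at `p` that avoids `M` can be enlarged to radius `τ`. -/
theorem HasUniqueNearest.inner_le_of_le_dist (hU : HasUniqueNearest τ M) (hM : IsClosed M)
    {p v : E} {t : ℝ} (hp : p ∈ M) (ht : 0 < t) (htτ : t < τ) (hv : ‖v‖ = 1)
    (hnear : ∀ z ∈ M, t ≤ dist (p + t • v) z) {q : E} (hq : q ∈ M) :
    2 * τ * ⟪v, q - p⟫ ≤ ‖q - p‖ ^ 2 := by
  have key : ∀ r, t ≤ r → r < τ → 2 * r * ⟪v, q - p⟫ ≤ ‖q - p‖ ^ 2 := by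
    intro r htr hrτ
    have h1 := hU.le_infDist_add hM (a := p + t • v) (s := r - t) hp ht (by linarith)
      (by linarith) hv (by simp) hnear
    rw [add_assoc, ← add_smul, add_sub_cancel] at h1
    have h2 := h1.trans (Metric.infDist_le_dist_of_mem hq)
    rw [dist_comm, dist_eq_norm, ← sub_sub] at h2
    have h3 := pow_le_pow_left₀ (by linarith) h2 2
    rw [norm_sub_sq_real, inner_smul_right, norm_smul, hv, mul_one, Real.norm_eq_abs, sq_abs,
      real_inner_comm] at h3
    linarith
  by_contra! hlt
  have hx : 0 < ⟪v, q - p⟫ := by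
    by_contra! hx
    nlinarith [sq_nonneg ‖q - p‖, mul_nonneg (ht.trans htτ).le (neg_nonneg.2 hx)]
  obtain ⟨r, hr1, hr2⟩ := exists_between
    (max_lt htτ ((div_lt_iff₀ (by positivity : 0 < 2 * ⟪v, q - p⟫)).2
      (by linarith : ‖q - p‖ ^ 2 < τ * (2 * ⟪v, q - p⟫))))
  have h1 := key r ((le_max_left _ _).trans hr1.le) hr2
  have h2 := (div_lt_iff₀ (by positivity)).1 ((le_max_right _ _).trans_lt hr1)
  linarith

/-- Second-order contact keeps a sufficiently small ball tangent at `p` in direction `v` clear of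
`M`; that ball is then enlarged. -/
theorem HasUniqueNearest.inner_le_of_isBigO (hU : HasUniqueNearest τ M) (hM : IsClosed M)
    (hτ : 0 < τ) {p v : E} (hp : p ∈ M)
    (hO : (fun q => ⟪v, q - p⟫) =O[𝓝[M] p] fun q => ‖q - p‖ ^ 2) {q : E} (hq : q ∈ M) :
    2 * ⟪v, q - p⟫ ≤ τ⁻¹ * ‖v‖ * ‖q - p‖ ^ 2 := by
  wlog hv : ‖v‖ = 1 generalizing v
  · rcases eq_or_ne v 0 with rfl | hv0
    · simp
    have hvpos := norm_pos_iff.2 hv0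
    have h1 := this (v := ‖v‖⁻¹ • v) (by
      simp only [inner_smul_left]
      exact hO.const_mul_left _) (by
        rw [norm_smul, norm_inv, norm_norm, inv_mul_cancel₀ hvpos.ne'])
    rw [norm_smul, norm_inv, norm_norm, inv_mul_cancel₀ hvpos.ne', inner_smul_left] at h1
    simp only [conj_trivial, mul_one] at h1
    have h2 := mul_le_mul_of_nonneg_left h1 hvpos.le
    calc 2 * ⟪v, q - p⟫ = ‖v‖ * (2 * (‖v‖⁻¹ * ⟪v, q - p⟫)) := by field_simp
      _ ≤ _ := h2
      _ = _ := by ring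
  obtain ⟨C, hC⟩ := hO.bound
  obtain ⟨ε, hε, hball⟩ := Metric.eventually_nhds_iff.1 (eventually_nhdsWithin_iff.1 hC)
  -- The three bounds on the radius keep it within the reach, exclude points at distance at least
  -- `ε` by Cauchy–Schwarz, and beat the contact constant at nearer points.
  set t := min (τ / 2) (min (ε / 2) (1 / (2 * (|C| + 1)))) with htdef
  have ht : 0 < t := by positivity
  have hCt : 2 * t * (|C| + 1) ≤ 1 := by
    have h1 : t ≤ 1 / (2 * (|C| + 1)) := (min_le_right _ _).trans (min_le_right _ _)
    rw [le_div_iff₀ (by positivity)] at h1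
    linarith
  have htε : 2 * t ≤ ε := by
    have h1 : t ≤ ε / 2 := (min_le_right _ _).trans (min_le_left _ _)
    linarith
  have htτ : t < τ := lt_of_le_of_lt (min_le_left _ _) (by linarith)
  have hnear : ∀ z ∈ M, t ≤ dist (p + t • v) z := by
    intro z hz
    have h1 : 2 * t * ⟪v, z - p⟫ ≤ ‖z - p‖ ^ 2 := by
      rcases lt_or_ge (dist z p) ε with hlt | hge
      · have h2 := hball hlt hz
        rw [norm_pow, norm_norm, Real.norm_eq_abs] at h2
        have h3 : ⟪v, z - p⟫ ≤ (|C| + 1) * ‖z - p‖ ^ 2 := by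
          refine ((le_abs_self _).trans h2).trans ?_
          gcongr
          linarith [le_abs_self C]
        calc 2 * t * ⟪v, z - p⟫ ≤ 2 * t * ((|C| + 1) * ‖z - p‖ ^ 2) := by gcongr
          _ = 2 * t * (|C| + 1) * ‖z - p‖ ^ 2 := by ring
          _ ≤ 1 * ‖z - p‖ ^ 2 := by gcongr
          _ = _ := one_mul _
      · rw [dist_eq_norm] at hge
        have h2 := real_inner_le_norm v (z - p)
        rw [hv, one_mul] at h2
        calc 2 * t * ⟪v, z - p⟫ ≤ 2 * t * ‖z - p‖ := by gcongr
          _ ≤ ‖z - p‖ * ‖z - p‖ := by gcongr; linarith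
          _ = _ := by ring
    rw [dist_comm, dist_eq_norm, ← sub_sub]
    refine abs_le_of_sq_le_sq' ?_ (norm_nonneg _) |>.2
    rw [norm_sub_sq_real, inner_smul_right, norm_smul, hv, mul_one, Real.norm_eq_abs, sq_abs,
      real_inner_comm]
    linarith
  have h := hU.inner_le_of_le_dist hM hp ht htτ hv hnear hq
  rw [hv, mul_one, ← div_eq_inv_mul, le_div_iff₀ hτ]
  linarith

theorem HasUniqueNearest.inner_le_of_nearest (hU : HasUniqueNearest τ M) (hM : IsClosed M)
    {a m : E} (hm : m ∈ M) (hnear : dist a m = Metric.infDist a M) (hlt : dist a m < τ) {z : E}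
    (hz : z ∈ M) : 2 * τ * ⟪a - m, z - m⟫ ≤ ‖a - m‖ * ‖z - m‖ ^ 2 := by
  rcases eq_or_ne a m with rfl | hne
  · simp
  have hpos : 0 < ‖a - m‖ := norm_pos_iff.2 (sub_ne_zero.2 hne)
  have h := hU.inner_le_of_le_dist hM (v := ‖a - m‖⁻¹ • (a - m)) hm hpos
    (by rwa [← dist_eq_norm]) (by rw [norm_smul, norm_inv, norm_norm, inv_mul_cancel₀ hpos.ne'])
    (fun z hz => by
      rw [smul_smul, mul_inv_cancel₀ hpos.ne', one_smul, add_sub_cancel, ← dist_eq_norm, hnear]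
      exact Metric.infDist_le_dist_of_mem hz) hz
  rw [inner_smul_left] at h
  simp only [conj_trivial] at h
  calc 2 * τ * ⟪a - m, z - m⟫ = ‖a - m‖ * (2 * τ * (‖a - m‖⁻¹ * ⟪a - m, z - m⟫)) := by
        field_simp
    _ ≤ _ := by gcongr

/-- Nearest points depend on the base point in a Lipschitz way within half the reach. -/
theorem HasUniqueNearest.dist_nearest_le (hU : HasUniqueNearest τ M) (hM : IsClosed M)
    (hτ : 0 < τ) {a b m l : E} (hm : m ∈ M) (hl : l ∈ M) (ham : dist a m = Metric.infDist a M)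
    (hbl : dist b l = Metric.infDist b M) (ha : dist a m ≤ τ / 2) (hb : dist b l ≤ τ / 2) :
    ‖m - l‖ ≤ 2 * ‖a - b‖ := by
  have h1 := hU.inner_le_of_nearest hM hm ham (by linarith) hl
  have h2 := hU.inner_le_of_nearest hM hl hbl (by linarith) hm
  rw [dist_eq_norm] at ha hb
  -- Each of the first two terms costs at most `‖m - l‖ ^ 2 / 4`, so half of the square survives.
  have h3 : ⟪a - b, m - l⟫ = -⟪a - m, l - m⟫ - ⟪b - l, m - l⟫ + ‖m - l‖ ^ 2 := by
    rw [← real_inner_self_eq_norm_sq, show a - b = (a - m) - (b - l) + (m - l) by abel,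
      inner_add_left, inner_sub_left, ← neg_sub m l, inner_neg_right, neg_neg]
  rw [norm_sub_rev l m] at h1
  have h4 : 2 * τ * ⟪a - m, l - m⟫ ≤ 2 * τ * (‖m - l‖ ^ 2 / 4) := by
    refine h1.trans ?_
    nlinarith [mul_le_mul_of_nonneg_right ha (sq_nonneg ‖m - l‖)]
  have h5 : 2 * τ * ⟪b - l, m - l⟫ ≤ 2 * τ * (‖m - l‖ ^ 2 / 4) := by
    refine h2.trans ?_
    nlinarith [mul_le_mul_of_nonneg_right hb (sq_nonneg ‖m - l‖)]
  have h6 := le_of_mul_le_mul_left h4 (by positivity)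
  have h7 := le_of_mul_le_mul_left h5 (by positivity)
  have h8 := real_inner_le_norm (a - b) (m - l)
  rcases (norm_nonneg (m - l)).eq_or_lt with h0 | h0
  · rw [← h0]; positivity
  · refine le_of_mul_le_mul_right (a := ‖m - l‖) ?_ h0
    nlinarith

end Reach

/-- The supremum defining the reach need not be attained, hence the strict inequality in
`HasUniqueNearest`. -/
theorem hasUniqueNearest_of_le_reach {n : ℕ} {M : Set (EuclideanSpace ℝ (Fin n))} {τ : ℝ}
    (h : ENNReal.ofReal τ ≤ reach M) : HasUniqueNearest τ M := by
  intro x hx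
  have hτ : 0 < τ := Metric.infDist_nonneg.trans_lt hx
  have h1 : ENNReal.ofReal (Metric.infDist x M) < reach M :=
    ((ENNReal.ofReal_lt_ofReal_iff hτ).2 hx).trans_le h
  rw [reach] at h1
  obtain ⟨r, h2⟩ := lt_iSup_iff.1 h1
  obtain ⟨hr, h3⟩ := lt_iSup_iff.1 h2
  refine hr x ?_
  rw [ENNReal.ofReal_lt_coe_iff Metric.infDist_nonneg] at h3
  exact h3.le

end

/-! ### Lipschitz paths in `M` and the variation of tangent spaces along them. -/

section

variable {n : ℕ} {M : Set (EuclideanSpace ℝ (Fin n))}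

/-- The metric and differential properties of a set of reach at least `k⁻¹` with `Λ`-Lipschitz
second fundamental form, where `ξ` selects nearest points. -/
structure ReachGeometry (M : Set (EuclideanSpace ℝ (Fin n))) (k Λ : ℝ)
    (ξ : EuclideanSpace ℝ (Fin n) → EuclideanSpace ℝ (Fin n)) : Prop where
  k_pos : 0 < k
  Λ_nonneg : 0 ≤ Λ
  hasFDerivWithinAt : ∀ p ∈ M, HasFDerivWithinAt (tangentProj M) (derivTangentProj M p) M p
  inner_deriv : ∀ p ∈ M, ∀ w u v, ⟪derivTangentProj M p w u, v⟫ =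
    ⟪secondFundamentalForm M p w u, v⟫ + ⟪u, secondFundamentalForm M p w v⟫
  symm : ∀ p ∈ M, ∀ w u, secondFundamentalForm M p w u = secondFundamentalForm M p u w
  bound : ∀ p ∈ M, ∀ w u v, |⟪v, secondFundamentalForm M p w u⟫| ≤ k * ‖v‖ * ‖w‖ * ‖u‖
  lipschitz : HasLipschitzSecondFundamentalForm Λ M
  inner_le : ∀ p ∈ M, ∀ v, tangentProj M p v = 0 → ∀ q ∈ M,
    2 * ⟪v, q - p⟫ ≤ k * ‖v‖ * ‖q - p‖ ^ 2
  mem : ∀ a, ξ a ∈ M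
  dist_eq : ∀ a, dist a (ξ a) = Metric.infDist a M
  normal : ∀ a, tangentProj M (ξ a) (a - ξ a) = 0
  nearest_lipschitz : ∀ a b, k * Metric.infDist a M ≤ 1 / 2 → k * Metric.infDist b M ≤ 1 / 2 →
    ‖ξ a - ξ b‖ ≤ 2 * ‖a - b‖

/-- An `L`-Lipschitz path in `M`, parametrized by the unit interval. -/
structure IsPath (M : Set (EuclideanSpace ℝ (Fin n))) (L : ℝ)
    (γ : ℝ → EuclideanSpace ℝ (Fin n)) : Prop where
  mem : ∀ t ∈ Icc (0 : ℝ) 1, γ t ∈ M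
  norm_sub_le : ∀ s ∈ Icc (0 : ℝ) 1, ∀ t ∈ Icc (0 : ℝ) 1, ‖γ s - γ t‖ ≤ L * |s - t|

namespace IsPath

variable {L : ℝ} {γ : ℝ → EuclideanSpace ℝ (Fin n)}

theorem continuousOn (h : IsPath M L γ) : ContinuousOn γ (Icc 0 1) := by
  refine (LipschitzOnWith.of_dist_le_mul (K := L.toNNReal) fun s hs t ht => ?_).continuousOn
  rw [dist_eq_norm, Real.dist_eq]
  exact (h.norm_sub_le s hs t ht).trans
    (mul_le_mul_of_nonneg_right (Real.le_coe_toNNReal L) (abs_nonneg _))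

theorem eventually_mem {t : ℝ} (ht : t ∈ Ico (0 : ℝ) 1) :
    ∀ᶠ z in 𝓝[>] t, z ∈ Icc (0 : ℝ) 1 ∧ 0 ≤ z - t := by
  filter_upwards [Ioo_mem_nhdsGT ht.2] with z hz
  exact ⟨⟨ht.1.trans hz.1.le, hz.2.le⟩, by linarith [hz.1]⟩

theorem isBigO (h : IsPath M L γ) {t : ℝ} (ht : t ∈ Ico (0 : ℝ) 1) :
    (fun z => γ z - γ t) =O[𝓝[>] t] fun z => z - t := by
  refine IsBigO.of_bound L ?_
  filter_upwards [eventually_mem ht] with z hz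
  exact h.norm_sub_le z hz.1 t ⟨ht.1, ht.2.le⟩

theorem tendsto (h : IsPath M L γ) {t : ℝ} (ht : t ∈ Ico (0 : ℝ) 1) :
    Tendsto γ (𝓝[>] t) (𝓝[M] γ t) := by
  refine tendsto_nhdsWithin_iff.2 ⟨?_, ?_⟩
  · exact (h.continuousOn t ⟨ht.1, ht.2.le⟩).tendsto.mono_left
      (nhdsWithin_le_of_mem (mem_of_superset (Ioo_mem_nhdsGT ht.2)
        fun z hz => ⟨ht.1.trans hz.1.le, hz.2.le⟩))
  · filter_upwards [eventually_mem ht] with z hz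
    exact h.mem z hz.1

end IsPath

theorem isLittleO_sub_sq (t : ℝ) : (fun z => (z - t) ^ 2) =o[𝓝[>] t] fun z => z - t := by
  have h0 : (fun z => z - t) =o[𝓝[>] t] fun _ => (1 : ℝ) := by
    rw [isLittleO_one_iff]
    have : Tendsto (fun z => z - t) (𝓝 t) (𝓝 (t - t)) := tendsto_id.sub_const t
    rw [sub_self] at this
    exact this.mono_left nhdsWithin_le_nhds
  simpa [pow_two] using (isBigO_refl (fun z : ℝ => z - t) _).mul_isLittleO h0

/-- A mean value inequality for functions with right slopes bounded by `K`. -/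
theorem le_add_of_right_slope_le {f : ℝ → ℝ} {K : ℝ} (hf : ContinuousOn f (Icc 0 1))
    (h : ∀ t ∈ Ico (0 : ℝ) 1, ∃ g : ℝ → ℝ, g =o[𝓝[>] t] (fun z => z - t) ∧
      ∀ᶠ z in 𝓝[>] t, f z - f t ≤ K * (z - t) + g z) :
    f 1 ≤ f 0 + K := by
  have := image_le_of_liminf_slope_right_le_deriv_boundary (B := fun t => f 0 + K * t)
    (B' := fun _ => K) hf (by simp) (by fun_prop)
    (fun x _ => by simpa using (((hasDerivAt_id x).const_mul K).const_add (f 0)).hasDerivWithinAt)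
    (fun t ht r hr => by
      obtain ⟨g, hg, hev⟩ := h t ht
      refine Eventually.frequently ?_
      filter_upwards [hev, hg.bound (half_pos (sub_pos.2 hr)), self_mem_nhdsWithin] with z h1 h2 h3
      have hz : 0 < z - t := sub_pos.2 h3
      rw [slope_def_field, div_lt_iff₀ hz]
      rw [Real.norm_eq_abs, Real.norm_of_nonneg hz.le] at h2
      nlinarith [le_abs_self (g z), mul_pos (sub_pos.2 hr) hz])
    (right_mem_Icc.2 zero_le_one)
  simpa using this

namespace ReachGeometry

variable {k Λ : ℝ} {ξ : EuclideanSpace ℝ (Fin n) → EuclideanSpace ℝ (Fin n)}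

/-- Apply the quadratic height bound with `v` the normal part of `q - p` itself. -/
theorem norm_normal_le (H : ReachGeometry M k Λ ξ) {p q : EuclideanSpace ℝ (Fin n)} (hp : p ∈ M)
    (hq : q ∈ M) : ‖q - p - tangentProj M p (q - p)‖ ≤ k / 2 * ‖q - p‖ ^ 2 := by
  set v := q - p - tangentProj M p (q - p)
  have hv : tangentProj M p v = 0 := tangentProj_sub_self _ _ _
  have h1 := H.inner_le p hp v hv q hq
  have h2 : ⟪v, q - p⟫ = ‖v‖ ^ 2 := by
    rw [← real_inner_self_eq_norm_sq]
    change _ = ⟪v, q - p - tangentProj M p (q - p)⟫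
    rw [inner_sub_right v (q - p), ← inner_tangentProj, hv, inner_zero_left, sub_zero]
  rw [h2] at h1
  rcases (norm_nonneg v).eq_or_lt with h0 | h0
  · rw [← h0]
    have := H.k_pos
    positivity
  · refine le_of_mul_le_mul_left (a := 2 * ‖v‖) ?_ (by positivity)
    linarith

theorem nearest_self (H : ReachGeometry M k Λ ξ) {p : EuclideanSpace ℝ (Fin n)} (hp : p ∈ M) :
    ξ p = p := by
  have := H.dist_eq p
  rw [Metric.infDist_zero_of_mem hp, dist_eq_zero] at this
  exact this.symm

/-- The path is the nearest point projection of the segment. Each point of the segment is within `‖q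
- p‖ / 2` of an endpoint, so the Lipschitz bound with factor 2 applies. -/
theorem exists_path (H : ReachGeometry M k Λ ξ) {p q : EuclideanSpace ℝ (Fin n)} (hp : p ∈ M)
    (hq : q ∈ M) (hpq : k * ‖q - p‖ ≤ 1) :
    ∃ γ, IsPath M (2 * ‖q - p‖) γ ∧ γ 0 = p ∧ γ 1 = q := by
  refine ⟨fun t => ξ (p + t • (q - p)), ⟨fun t _ => H.mem _, ?_⟩, ?_, ?_⟩
  · have hd : ∀ t ∈ Icc (0 : ℝ) 1, k * Metric.infDist (p + t • (q - p)) M ≤ 1 / 2 := by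
      intro t ht
      have h1 : Metric.infDist (p + t • (q - p)) M ≤ 1 / 2 * ‖q - p‖ := by
        rcases le_total t (1 / 2) with h | h
        · refine (Metric.infDist_le_dist_of_mem hp).trans ?_
          rw [dist_self_add_left, norm_smul, Real.norm_of_nonneg ht.1]
          gcongr
        · refine (Metric.infDist_le_dist_of_mem hq).trans ?_
          rw [dist_comm, dist_eq_norm, show q - (p + t • (q - p)) = (1 - t) • (q - p) by module,
            norm_smul, Real.norm_of_nonneg (by linarith [ht.2])]
          gcongr
          linarith
      calc k * Metric.infDist (p + t • (q - p)) M ≤ k * (1 / 2 * ‖q - p‖) :=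
            mul_le_mul_of_nonneg_left h1 H.k_pos.le
        _ ≤ 1 / 2 := by linarith
    intro s hs t ht
    refine (H.nearest_lipschitz _ _ (hd s hs) (hd t ht)).trans (le_of_eq ?_)
    rw [show p + s • (q - p) - (p + t • (q - p)) = (s - t) • (q - p) by module, norm_smul,
      Real.norm_eq_abs]
    ring
  · simp [H.nearest_self hp]
  · simp [H.nearest_self hq]

theorem continuousOn_tangentProj (H : ReachGeometry M k Λ ξ) : ContinuousOn (tangentProj M) M :=
  fun p hp => (H.hasFDerivWithinAt p hp).continuousWithinAt

section Path

variable {L : ℝ} {γ : ℝ → EuclideanSpace ℝ (Fin n)}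

theorem continuousOn_path (H : ReachGeometry M k Λ ξ) (h : IsPath M L γ)
    (u : EuclideanSpace ℝ (Fin n)) : ContinuousOn (fun t => tangentProj M (γ t) u) (Icc 0 1) :=
  (H.continuousOn_tangentProj.comp h.continuousOn h.mem).clm_apply continuousOn_const

theorem isLittleO_tangentProj (H : ReachGeometry M k Λ ξ) (h : IsPath M L γ) {t : ℝ}
    (ht : t ∈ Ico (0 : ℝ) 1) (u v : EuclideanSpace ℝ (Fin n)) :
    (fun z => ⟪tangentProj M (γ z) u - tangentProj M (γ t) u, v⟫ -
      (⟪secondFundamentalForm M (γ t) (γ z - γ t) u, v⟫ +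
        ⟪u, secondFundamentalForm M (γ t) (γ z - γ t) v⟫)) =o[𝓝[>] t] fun z => z - t := by
  have hmem := h.mem t ⟨ht.1, ht.2.le⟩
  have h1 := ((H.hasFDerivWithinAt _ hmem).isLittleO.comp_tendsto (h.tendsto ht)).trans_isBigO
    (h.isBigO ht)
  have h2 := (((innerSL ℝ v).comp
    (ContinuousLinearMap.apply ℝ (EuclideanSpace ℝ (Fin n)) u)).isBigO_comp _ _).trans_isLittleO h1
  refine h2.congr_left fun z => ?_
  rw [← H.inner_deriv _ hmem]
  simp [inner_sub_right, inner_sub_left, real_inner_comm]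

/-- Increments of a path in `M` are tangent up to second order; this stands in for a tangent
velocity, which a Lipschitz path may lack. -/
theorem isLittleO_normal (H : ReachGeometry M k Λ ξ) (h : IsPath M L γ) {t : ℝ}
    (ht : t ∈ Ico (0 : ℝ) 1) (v : EuclideanSpace ℝ (Fin n)) :
    (fun z => ⟪v, γ z - γ t - tangentProj M (γ t) (γ z - γ t)⟫) =o[𝓝[>] t] fun z => z - t := by
  have hmem := h.mem t ⟨ht.1, ht.2.le⟩
  have h2 : (fun z => γ z - γ t - tangentProj M (γ t) (γ z - γ t)) =O[𝓝[>] t]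
      fun z => (z - t) ^ 2 := by
    refine IsBigO.trans (IsBigO.of_bound (k / 2) ?_) ((h.isBigO ht).norm_left.pow 2)
    filter_upwards [IsPath.eventually_mem ht] with z hz
    rw [norm_pow, norm_norm]
    exact H.norm_normal_le hmem (h.mem z hz.1)
  exact ((innerSL ℝ v).isBigO_comp _ _).trans_isLittleO (h2.trans_isLittleO (isLittleO_sub_sq t))

end Path

/-- The tangential projection depends on the base point in a Lipschitz way. -/
theorem norm_tangentProj_sub_le (H : ReachGeometry M k Λ ξ) {p q : EuclideanSpace ℝ (Fin n)}
    (hp : p ∈ M) (hq : q ∈ M) (hpq : k * ‖q - p‖ ≤ 1) (u : EuclideanSpace ℝ (Fin n)) :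
    ‖tangentProj M q u - tangentProj M p u‖ ≤ 4 * k * ‖q - p‖ * ‖u‖ := by
  have hk := H.k_pos
  have key : ∀ v, ⟪tangentProj M q u - tangentProj M p u, v⟫ ≤ 4 * k * ‖q - p‖ * ‖u‖ * ‖v‖ := by
    intro v
    obtain ⟨γ, hγ, rfl, rfl⟩ := H.exists_path hp hq hpq
    set r := ‖γ 1 - γ 0‖
    have h := le_add_of_right_slope_le (f := fun t => ⟪tangentProj M (γ t) u, v⟫)
      (K := 4 * k * r * ‖u‖ * ‖v‖) ((H.continuousOn_path hγ u).inner continuousOn_const)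
      (fun t ht => ⟨_, H.isLittleO_tangentProj hγ ht u v, ?_⟩)
    · rw [inner_sub_left]
      linarith
    · have ht' : t ∈ Icc (0 : ℝ) 1 := ⟨ht.1, ht.2.le⟩
      filter_upwards [IsPath.eventually_mem ht] with z hz
      have h1 := H.bound _ (hγ.mem t ht') (γ z - γ t) u v
      have h2 := H.bound _ (hγ.mem t ht') (γ z - γ t) v u
      have h3 := hγ.norm_sub_le z hz.1 t ht'
      rw [abs_of_nonneg hz.2] at h3
      rw [real_inner_comm] at h1
      have h4 := mul_le_mul_of_nonneg_left h3
        (by positivity : 0 ≤ 2 * (k * ‖u‖ * ‖v‖))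
      rw [inner_sub_left]
      linarith [(abs_le.1 h1).2, (abs_le.1 h2).2]
  have h1 := key (tangentProj M q u - tangentProj M p u)
  rw [real_inner_self_eq_norm_sq] at h1
  rcases (norm_nonneg (tangentProj M q u - tangentProj M p u)).eq_or_lt with h0 | h0
  · rw [← h0]
    positivity
  · exact le_of_mul_le_mul_right (by linarith) h0

theorem norm_tangentProj_le_of_normal (H : ReachGeometry M k Λ ξ)
    {p q : EuclideanSpace ℝ (Fin n)} (hp : p ∈ M) (hq : q ∈ M) (hpq : k * ‖q - p‖ ≤ 1)
    {v : EuclideanSpace ℝ (Fin n)} (hv : tangentProj M p v = 0) :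
    ‖tangentProj M q v‖ ≤ 4 * k * ‖q - p‖ * ‖v‖ := by
  simpa [hv] using H.norm_tangentProj_sub_le hp hq hpq v

/-- First-order expansion of the tangential projection, paired with a normal vector. -/
theorem inner_tangentProj_le (H : ReachGeometry M k Λ ξ) {p q : EuclideanSpace ℝ (Fin n)}
    (hp : p ∈ M) (hq : q ∈ M) (hpq : k * ‖q - p‖ ≤ 1 / 2) {v : EuclideanSpace ℝ (Fin n)}
    (hv : tangentProj M p v = 0) (e : EuclideanSpace ℝ (Fin n)) :
    ⟪tangentProj M q e, v⟫ ≤ ⟪v, secondFundamentalForm M p (q - p) e⟫ +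
      16 * (Λ + k ^ 2) * ‖q - p‖ ^ 2 * ‖v‖ * ‖e‖ := by
  have hk := H.k_pos
  have hΛ := H.Λ_nonneg
  obtain ⟨γ, hγ, rfl, rfl⟩ := H.exists_path hp hq (by linarith)
  set r := ‖γ 1 - γ 0‖
  have hr : 0 ≤ r := norm_nonneg _
  -- The slope of this difference has two parts: `II` at `γ t` applied to the tangential part of
  -- `v`, which is small as `v` is normal at `γ 0`, and the change of `II` between `γ 0` and `γ t`.
  -- They contribute `16 k²` and `4 Λ`.
  have h := le_add_of_right_slope_le
    (f := fun t => ⟪tangentProj M (γ t) e, v⟫ -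
      ⟪v, secondFundamentalForm M (γ 0) (γ t - γ 0) e⟫)
    (K := 16 * (Λ + k ^ 2) * r ^ 2 * ‖v‖ * ‖e‖)
    (((H.continuousOn_path hγ e).inner continuousOn_const).sub
      (continuousOn_const.inner (((secondFundamentalForm M (γ 0)).continuous.comp_continuousOn
        (hγ.continuousOn.sub continuousOn_const)).clm_apply continuousOn_const)))
    (fun t ht => ⟨_, H.isLittleO_tangentProj hγ ht e v, ?_⟩)
  · simp only [sub_self, map_zero, zero_apply, inner_zero_right, inner_tangentProj, hv]
      at h
    rw [inner_tangentProj]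
    linarith
  · have ht' : t ∈ Icc (0 : ℝ) 1 := ⟨ht.1, ht.2.le⟩
    have ht0 : ‖γ t - γ 0‖ ≤ 2 * r := by
      have := hγ.norm_sub_le t ht' 0 ⟨le_rfl, zero_le_one⟩
      rw [sub_zero, abs_of_nonneg ht.1] at this
      nlinarith [ht.2]
    have hkt : k * ‖γ t - γ 0‖ ≤ 1 := by
      calc k * ‖γ t - γ 0‖ ≤ k * (2 * r) := by gcongr
        _ ≤ 1 := by linarith
    have hvt : ‖tangentProj M (γ t) v‖ ≤ 4 * k * (2 * r) * ‖v‖ :=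
      (H.norm_tangentProj_le_of_normal hp (hγ.mem t ht') hkt hv).trans (by gcongr)
    filter_upwards [IsPath.eventually_mem ht] with z hz
    have hδ := hγ.norm_sub_le z hz.1 t ht'
    rw [abs_of_nonneg hz.2] at hδ
    have hz0 := hz.2
    have h1 : ⟪e, secondFundamentalForm M (γ t) (γ z - γ t) v⟫ ≤
        16 * k ^ 2 * r ^ 2 * ‖v‖ * ‖e‖ * (z - t) := by
      rw [← secondFundamentalForm_tangentProj]
      refine ((le_abs_self _).trans (H.bound _ (hγ.mem t ht') _ _ _)).trans ?_
      calc k * ‖e‖ * ‖γ z - γ t‖ * ‖tangentProj M (γ t) v‖ ≤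
            k * ‖e‖ * (2 * r * (z - t)) * (4 * k * (2 * r) * ‖v‖) := by gcongr
        _ = _ := by ring
    have h2 : ⟪v, secondFundamentalForm M (γ t) (γ z - γ t) e⟫ -
        ⟪v, secondFundamentalForm M (γ 0) (γ z - γ t) e⟫ ≤
        4 * Λ * r ^ 2 * ‖v‖ * ‖e‖ * (z - t) := by
      rw [← inner_sub_right]
      refine (real_inner_le_norm _ _).trans ?_
      have h3 := ContinuousLinearMap.le_opNorm₂
        (secondFundamentalForm M (γ t) - secondFundamentalForm M (γ 0)) (γ z - γ t) e
      have h4 := H.lipschitz _ (hγ.mem t ht') _ hp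
      calc _ ≤ ‖v‖ * (Λ * (2 * r) * (2 * r * (z - t)) * ‖e‖) := by
            gcongr
            refine LE.le.trans h3 ?_
            gcongr
            exact h4.trans (by gcongr)
        _ = _ := by ring
    have h5 : ⟪v, secondFundamentalForm M (γ 0) (γ z - γ 0) e⟫ -
        ⟪v, secondFundamentalForm M (γ 0) (γ t - γ 0) e⟫ =
        ⟪v, secondFundamentalForm M (γ 0) (γ z - γ t) e⟫ := by
      rw [← inner_sub_right, ← sub_apply, ← map_sub, sub_sub_sub_cancel_right]
    have h6 : 0 ≤ Λ * r ^ 2 * ‖v‖ * ‖e‖ * (z - t) := by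
      positivity
    rw [inner_sub_left,
      real_inner_comm v (secondFundamentalForm M (γ t) (γ z - γ t) e)]
    linarith

end ReachGeometry

end

/-! ### Transport of the height function from `y` to `x`. -/

section

variable {n : ℕ} {M : Set (EuclideanSpace ℝ (Fin n))}

theorem inner_sub_tangentProj (M : Set (EuclideanSpace ℝ (Fin n)))
    (p v w : EuclideanSpace ℝ (Fin n)) :
    ⟪v - tangentProj M p v, w - tangentProj M p w⟫ = ⟪v - tangentProj M p v, w⟫ := by
  rw [inner_sub_right (v - tangentProj M p v), ← inner_tangentProj, tangentProj_sub_self,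
    inner_zero_left, sub_zero]

theorem inner_sub_tangentProj_secondFundamentalForm (p v w u : EuclideanSpace ℝ (Fin n)) :
    ⟪v - tangentProj M p v, secondFundamentalForm M p w u⟫ =
      ⟪v, secondFundamentalForm M p w u⟫ := by
  rw [inner_sub_left, inner_tangentProj, tangentProj_secondFundamentalForm, inner_zero_right,
    sub_zero]

namespace ReachGeometry

variable {k Λ : ℝ} {ξ : EuclideanSpace ℝ (Fin n) → EuclideanSpace ℝ (Fin n)}

/-- The comparison of the height function of `v` above the tangent spaces at the points `b` and
`b + δb`, where the point at which the height is measured moves from `a` to `a + δa`. The vectors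
`m` and `m'` are normal at `a` and `a + δa`. -/
theorem height_variation_le (H : ReachGeometry M k Λ ξ)
    {a b δa δb m m' v : EuclideanSpace ℝ (Fin n)} {ε r : ℝ} (ha : a ∈ M) (hb : b ∈ M)
    (ha' : a + δa ∈ M) (hε : 0 ≤ ε) (hr : 0 ≤ r) (hkε : 4 * (k * ε) ≤ 1) (hkr : 4 * (k * r) ≤ 1)
    (hv : ‖v‖ ≤ 1) (hvb : ‖tangentProj M b v‖ ≤ 8 * k * ε) (hab : ‖a - b‖ ≤ 2 * r)
    (hm : tangentProj M a m = 0) (hm' : tangentProj M (a + δa) m' = 0) (hm'r : ‖m'‖ ≤ r)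
    (hδ : δb = δa + (m' - m)) {h : ℝ} (hh : 0 ≤ h) (hh1 : h ≤ 1) (hδb : ‖δb‖ ≤ 2 * ε * h)
    (hδa : ‖δa‖ ≤ 4 * ε * h) :
    ⟪v - tangentProj M b v, tangentProj M a δa⟫ -
      (⟪secondFundamentalForm M b δb v, a - b⟫ + ⟪v, secondFundamentalForm M b δb (a - b)⟫) ≤
      264 * (Λ + k ^ 2) * ε * r ^ 2 * h := by
  have hk := H.k_pos
  have hΛ := H.Λ_nonneg
  set vN := v - tangentProj M b v
  have hvN1 : ‖vN‖ ≤ 1 := (norm_sub_tangentProj_le _ _ _).trans hv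
  have hvNb : tangentProj M b vN = 0 := tangentProj_sub_self _ _ _
  have hkab : k * ‖a - b‖ ≤ 1 / 2 := by
    calc k * ‖a - b‖ ≤ k * (2 * r) := by gcongr
      _ ≤ 1 / 2 := by linarith
  have hkδa : k * ‖δa‖ ≤ 1 := by
    calc k * ‖δa‖ ≤ k * (4 * ε * h) := by gcongr
      _ = 4 * (k * ε) * h := by ring
      _ ≤ 1 * 1 := by gcongr
      _ = 1 := one_mul 1
  -- Only the tangential part of `v`, of order `kε`, and the normal part of `a - b`, of order `k
  -- r²`, enter.
  have h1 : |⟪secondFundamentalForm M b δb v, a - b⟫| ≤ 8 * k ^ 2 * ε * r ^ 2 * h := by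
    have h2 : ⟪secondFundamentalForm M b δb v, a - b⟫ =
        ⟪a - b - tangentProj M b (a - b), secondFundamentalForm M b δb (tangentProj M b v)⟫ := by
      rw [inner_sub_tangentProj_secondFundamentalForm, secondFundamentalForm_tangentProj,
        real_inner_comm]
    rw [h2]
    refine (H.bound b hb _ _ _).trans ?_
    have h3 := H.norm_normal_le hb ha
    calc k * ‖a - b - tangentProj M b (a - b)‖ * ‖δb‖ * ‖tangentProj M b v‖
        ≤ k * (k / 2 * (2 * r) ^ 2) * (2 * ε * h) * (8 * k * ε) := by
          gcongr
          exact h3.trans (by gcongr)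
      _ = (4 * (k * ε)) * (8 * k ^ 2 * ε * r ^ 2 * h) := by ring
      _ ≤ 1 * (8 * k ^ 2 * ε * r ^ 2 * h) := by gcongr
      _ = _ := one_mul _
  have h4 : ⟪vN, tangentProj M a δa⟫ =
      ⟪tangentProj M a δb, vN⟫ - ⟪tangentProj M a vN, tangentProj M a m'⟫ := by
    rw [hδ, map_add, map_sub, hm, sub_zero, inner_add_left, inner_tangentProj M a vN,
      tangentProj_idem, real_inner_comm vN, real_inner_comm vN]
    ring
  -- Both vectors are normal at points near `a`: `vN` at `b`, within `2 * r`, and `m'` at `a + δa`,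
  -- within `4 * ε * h`.
  have h5 : |⟪tangentProj M a vN, tangentProj M a m'⟫| ≤ 128 * k ^ 2 * ε * r ^ 2 * h := by
    have h6 := H.norm_tangentProj_le_of_normal hb ha (by linarith) hvNb
    have h7 := H.norm_tangentProj_le_of_normal ha' ha
      (by rwa [sub_add_cancel_left, norm_neg]) hm'
    rw [sub_add_cancel_left, norm_neg] at h7
    refine (abs_real_inner_le_norm _ _).trans ?_
    calc ‖tangentProj M a vN‖ * ‖tangentProj M a m'‖
        ≤ (4 * k * (2 * r) * 1) * (4 * k * (4 * ε * h) * r) := by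
          gcongr
          · exact h6.trans (by gcongr)
          · exact h7.trans (by gcongr)
      _ = _ := by ring
  -- By symmetry of `II` the leading term is exactly the one subtracted in the statement; this
  -- cancellation leaves an error quadratic in `r`. The constant is `264 = 8 + 128 + 128`.
  have h8 : ⟪tangentProj M a δb, vN⟫ ≤ ⟪v, secondFundamentalForm M b δb (a - b)⟫ +
      128 * (Λ + k ^ 2) * ε * r ^ 2 * h := by
    refine (H.inner_tangentProj_le hb ha hkab hvNb δb).trans ?_
    rw [inner_sub_tangentProj_secondFundamentalForm, H.symm b hb]
    refine add_le_add le_rfl ?_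
    calc 16 * (Λ + k ^ 2) * ‖a - b‖ ^ 2 * ‖vN‖ * ‖δb‖
        ≤ 16 * (Λ + k ^ 2) * (2 * r) ^ 2 * 1 * (2 * ε * h) := by gcongr
      _ = _ := by ring
  have h9 : 0 ≤ Λ * (ε * r ^ 2 * h) := by positivity
  rw [h4]
  linarith [(abs_le.1 h1).1, (abs_le.1 h5).1]

/-- If the height function of `v` on `M` is maximal at `x`, then the height function of the normal
part of `v` at a nearby point `y` is almost maximal at `y`. -/
theorem inner_sub_tangentProj_le (H : ReachGeometry M k Λ ξ)
    {x y q v : EuclideanSpace ℝ (Fin n)} (hx : x ∈ M) (hy : y ∈ M) (hq : q ∈ M)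
    (hv : ‖v‖ ≤ 1) (hvx : tangentProj M x v = 0) (hmax : ∀ z ∈ M, ⟪v, z - x⟫ ≤ 0)
    (hxy : 4 * (k * ‖x - y‖) ≤ 1) (hqy : 4 * (k * ‖q - y‖) ≤ 1) :
    ⟪v - tangentProj M y v, q - y⟫ ≤
      264 * (Λ + k ^ 2) * ‖x - y‖ * ‖q - y‖ ^ 2 := by
  have hk := H.k_pos
  obtain ⟨β, hβ, rfl, rfl⟩ := H.exists_path hy hx
    (by linarith [mul_nonneg hk.le (norm_nonneg (x - y))])
  set ε := ‖β 1 - β 0‖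
  set r := ‖q - β 0‖
  have hε : 0 ≤ ε := norm_nonneg _
  have hr : 0 ≤ r := norm_nonneg _
  set a : ℝ → EuclideanSpace ℝ (Fin n) := fun t => q - β 0 + β t with ha
  set α : ℝ → EuclideanSpace ℝ (Fin n) := fun t => ξ (a t) with hα
  have hdist : ∀ t ∈ Icc (0 : ℝ) 1, Metric.infDist (a t) M ≤ r := fun t ht => by
    refine (Metric.infDist_le_dist_of_mem (hβ.mem t ht)).trans (le_of_eq ?_)
    rw [dist_eq_norm, ha, add_sub_cancel_right]
  have hnorm : ∀ t ∈ Icc (0 : ℝ) 1, ‖a t - α t‖ ≤ r := fun t ht => by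
    rw [← dist_eq_norm, H.dist_eq]
    exact hdist t ht
  have hkd : ∀ t ∈ Icc (0 : ℝ) 1, k * Metric.infDist (a t) M ≤ 1 / 2 := fun t ht => by
    have := mul_le_mul_of_nonneg_left (hdist t ht) hk.le
    linarith [mul_nonneg hk.le hr]
  have hαp : IsPath M (4 * ε) α := by
    refine ⟨fun t _ => H.mem _, fun s hs t ht => ?_⟩
    have h1 := H.nearest_lipschitz (a s) (a t) (hkd s hs) (hkd t ht)
    have h2 := hβ.norm_sub_le s hs t ht
    rw [show a s - a t = β s - β t by simp [ha]] at h1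
    linarith
  have hα0 : α 0 = q := by
    simp only [hα, ha, sub_add_cancel]
    exact H.nearest_self hq
  have hcont : ContinuousOn (fun t => ⟪v - tangentProj M (β t) v, α t - β t⟫) (Icc 0 1) :=
    (continuousOn_const.sub (H.continuousOn_path hβ v)).inner
      (hαp.continuousOn.sub hβ.continuousOn)
  -- The sign makes the upper bound at `1` usable: there the negated height is nonnegative by
  -- maximality at `x`, while at `0` it is minus the height to be bounded.
  have key := le_add_of_right_slope_le
    (f := fun t => -⟪v - tangentProj M (β t) v, α t - β t⟫)
    (K := 264 * (Λ + k ^ 2) * ε * r ^ 2) hcont.neg ?_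
  · simp only [hα0, hvx, sub_zero] at key
    have h1 := hmax (α 1) (H.mem _)
    linarith
  intro t ht
  have ht' : t ∈ Icc (0 : ℝ) 1 := ⟨ht.1, ht.2.le⟩
  have hβt : ‖β t - β 1‖ ≤ 2 * ε := by
    have h1 := hβ.norm_sub_le t ht' 1 ⟨zero_le_one, le_rfl⟩
    rw [abs_sub_comm, abs_of_nonneg (by linarith [ht.2])] at h1
    nlinarith [ht.1]
  have hkβt : k * ‖β t - β 1‖ ≤ 1 := by
    calc k * ‖β t - β 1‖ ≤ k * (2 * ε) := by gcongr
      _ ≤ 1 := by linarith [mul_nonneg hk.le hε]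
  have hvb : ‖tangentProj M (β t) (-v)‖ ≤ 8 * k * ε := by
    rw [map_neg, norm_neg]
    calc ‖tangentProj M (β t) v‖ ≤ 4 * k * ‖β t - β 1‖ * ‖v‖ :=
          H.norm_tangentProj_le_of_normal hx (hβ.mem t ht') hkβt hvx
      _ ≤ 4 * k * (2 * ε) * 1 := by gcongr
      _ = _ := by ring
  have hab : ‖α t - β t‖ ≤ 2 * r := by
    have h1 : α t - β t = (q - β 0) - (a t - α t) := by simp only [ha]; abel
    rw [h1]
    refine (norm_sub_le _ _).trans ?_
    linarith [hnorm t ht']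
  -- Four negligible errors: linearizing the projection along `β`, the normal part of the increment
  -- of `β`, the product of two increments, and the normal part of the increment of `α`.
  have hg1 := H.isLittleO_tangentProj hβ ht v (α t - β t)
  have hg2 := H.isLittleO_normal hβ ht (v - tangentProj M (β t) v)
  have hg3 : (fun z => ⟪tangentProj M (β z) v - tangentProj M (β t) v,
      (α z - α t) - (β z - β t)⟫) =o[𝓝[>] t] fun z => z - t := by
    refine IsBigO.trans_isLittleO (IsBigO.of_bound (4 * k * (2 * ε) * (6 * ε)) ?_)
      (isLittleO_sub_sq t)
    filter_upwards [IsPath.eventually_mem ht] with z hz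
    have h1 := hβ.norm_sub_le z hz.1 t ht'
    have h2 := hαp.norm_sub_le z hz.1 t ht'
    rw [abs_of_nonneg hz.2] at h1 h2
    have h3 : k * ‖β z - β t‖ ≤ 1 := by
      calc k * ‖β z - β t‖ ≤ k * (2 * ε * (z - t)) := by gcongr
        _ ≤ k * (2 * ε * 1) := by gcongr; linarith [hz.1.2, ht.1]
        _ ≤ 1 := by linarith [mul_nonneg hk.le hε]
    have h4 := H.norm_tangentProj_sub_le (hβ.mem t ht') (hβ.mem z hz.1) h3 v
    have hz0 := hz.2
    refine (norm_inner_le_norm _ _).trans ?_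
    calc _ ≤ (4 * k * (2 * ε * (z - t)) * 1) * (6 * ε * (z - t)) := by
          gcongr
          · exact h4.trans (by gcongr)
          · exact (norm_sub_le _ _).trans (by linarith)
      _ = _ := by rw [norm_pow, Real.norm_eq_abs, sq_abs]; ring
  have hg4 := H.isLittleO_normal hαp ht (v - tangentProj M (β t) v)
  refine ⟨_, ((hg1.add hg2).add hg3).sub hg4, ?_⟩
  filter_upwards [IsPath.eventually_mem ht] with z hz
  have h1 := hβ.norm_sub_le z hz.1 t ht'
  have h2 := hαp.norm_sub_le z hz.1 t ht'
  rw [abs_of_nonneg hz.2] at h1 h2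
  have h3 := H.height_variation_le (a := α t) (b := β t) (δa := α z - α t) (δb := β z - β t)
    (m := a t - α t) (m' := a z - α z) (v := -v) (hαp.mem t ht') (hβ.mem t ht')
    (by rw [add_sub_cancel]; exact hαp.mem z hz.1) hε hr hxy hqy (by rwa [norm_neg]) hvb hab
    (H.normal _) (by rw [add_sub_cancel]; exact H.normal _) (hnorm z hz.1)
    (by simp only [ha]; abel) hz.2 (by linarith [hz.1.2, ht.1]) h1 h2
  rw [map_neg, map_neg, ← neg_sub', inner_neg_left, inner_neg_left, inner_neg_left] at h3
  simp only [inner_sub_tangentProj]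
  have h4 : ∀ P P' A A' B B' : EuclideanSpace ℝ (Fin n),
      ⟪v - P', A' - B'⟫ - ⟪v - P, A - B⟫ = ⟪v - P, A' - A⟫ - ⟪v - P, B' - B⟫ -
        ⟪P' - P, A - B⟫ - ⟪P' - P, (A' - A) - (B' - B)⟫ := by
    intro P P' A A' B B'
    simp only [inner_sub_left, inner_sub_right]
    ring
  have h5 := h4 (tangentProj M (β t) v) (tangentProj M (β z) v) (α t) (α z) (β t) (β z)
  have h6 : ⟪v - tangentProj M (β t) v, α z - α t - tangentProj M (α t) (α z - α t)⟫ =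
      ⟪v - tangentProj M (β t) v, α z - α t⟫ -
        ⟪v - tangentProj M (β t) v, tangentProj M (α t) (α z - α t)⟫ := inner_sub_right _ _ _
  rw [h6]
  linarith

end ReachGeometry

end

/-! ### Verification of the geometric bounds and construction of outward normals. -/

section

variable {n d : ℕ} {M : Set (EuclideanSpace ℝ (Fin n))}

theorem IsC21Submanifold.isBigO_inner (hM : IsC21Submanifold d M)
    {p v : EuclideanSpace ℝ (Fin n)} (hp : p ∈ M) (hv : tangentProj M p v = 0) :
    (fun q => ⟪v, q - p⟫) =O[𝓝[M] p] fun q => ‖q - p‖ ^ 2 := by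
  obtain ⟨φ, ψ, a, h, -⟩ := hM.exists_chart hp
  refine h.isBigO_inner fun ξ => ?_
  exact (Submodule.mem_orthogonal' _ _).1 (tangentProj_eq_zero_iff.1 hv) _
    (h.fderiv_mem_tangentSpace ξ)

theorem IsC21Submanifold.tangentProj_eq_zero_of_isMinOn (hM : IsC21Submanifold d M)
    {p v : EuclideanSpace ℝ (Fin n)} (hp : p ∈ M) {f : EuclideanSpace ℝ (Fin n) → ℝ}
    (hf : HasFDerivAt f (innerSL ℝ v) p) (hmin : IsMinOn f M p) : tangentProj M p v = 0 := by
  obtain ⟨φ, ψ, a, h, -⟩ := hM.exists_chart hp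
  rw [tangentProj_eq_zero_iff, Submodule.mem_orthogonal']
  intro w hw
  exact h.fderiv_eq_zero_of_isMinOn hf hmin hw

theorem IsC21Submanifold.tangentProj_sub_nearest (hM : IsC21Submanifold d M)
    {a m : EuclideanSpace ℝ (Fin n)} (hm : m ∈ M) (hnear : dist a m = Metric.infDist a M) :
    tangentProj M m (a - m) = 0 := by
  have h1 : HasFDerivAt (fun q => ‖q - a‖ ^ 2) (innerSL ℝ ((2 : ℝ) • (m - a))) m := by
    refine ((hasFDerivAt_id m).sub_const a).norm_sq.congr_fderiv ?_
    ext w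
    simp
  have h2 : IsMinOn (fun q => ‖q - a‖ ^ 2) M m := by
    intro q hq
    have : ‖m - a‖ ≤ ‖q - a‖ := by
      rw [← dist_eq_norm, ← dist_eq_norm, dist_comm m, dist_comm q, hnear]
      exact Metric.infDist_le_dist_of_mem hq
    exact pow_le_pow_left₀ (norm_nonneg _) this 2
  have h3 := hM.tangentProj_eq_zero_of_isMinOn hm h1 h2
  rw [map_smul, smul_eq_zero_iff_right two_ne_zero] at h3
  rw [← neg_sub, map_neg, h3, neg_zero]

theorem IsC21Submanifold.tangentProj_eq_zero_of_forall_inner_le (hM : IsC21Submanifold d M)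
    {p v : EuclideanSpace ℝ (Fin n)} (hp : p ∈ M) (hv : ∀ q ∈ M, ⟪v, q - p⟫ ≤ 0) :
    tangentProj M p v = 0 := by
  have h1 : HasFDerivAt (fun q => innerSL ℝ (-v) q) (innerSL ℝ (-v)) p :=
    (innerSL ℝ (-v)).hasFDerivAt
  have h2 : IsMinOn (fun q => innerSL ℝ (-v) q) M p := by
    intro q hq
    have := hv q hq
    rw [inner_sub_right] at this
    simp only [mem_ofPred_eq, innerSL_apply_apply, inner_neg_left]
    linarith
  have h3 := hM.tangentProj_eq_zero_of_isMinOn hp h1 h2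
  rwa [map_neg, neg_eq_zero] at h3

theorem IsC21Submanifold.exists_reachGeometry (hM : IsC21Submanifold d M) (hcl : IsClosed M)
    (hne : M.Nonempty) {τ Λ : ℝ} (hτ : 0 < τ) (hΛ : 0 ≤ Λ) (hreach : ENNReal.ofReal τ ≤ reach M)
    (hII : HasLipschitzSecondFundamentalForm Λ M) : ∃ ξ, ReachGeometry M τ⁻¹ Λ ξ := by
  have hU := hasUniqueNearest_of_le_reach hreach
  choose ξ hξM hξ using fun a => hcl.exists_infDist_eq_dist hne a
  have hinner : ∀ p ∈ M, ∀ v, tangentProj M p v = 0 → ∀ q ∈ M,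
      2 * ⟪v, q - p⟫ ≤ τ⁻¹ * ‖v‖ * ‖q - p‖ ^ 2 := fun p hp v hv q hq =>
    hU.inner_le_of_isBigO hcl hτ hp (hM.isBigO_inner hp hv) hq
  refine ⟨ξ, inv_pos.2 hτ, hΛ, fun p hp => ?_, fun p hp => inner_derivTangentProj_eq hM hp,
    fun p hp => secondFundamentalForm_symm hM hp,
    fun p hp => abs_inner_secondFundamentalForm_le hM hp (inv_pos.2 hτ).le (hinner p hp), hII,
    hinner, hξM, fun a => (hξ a).symm,
    fun a => hM.tangentProj_sub_nearest (hξM a) (hξ a).symm, fun a b ha hb => ?_⟩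
  · have h1 := (hM.differentiableWithinAt_tangentProj hp).hasFDerivWithinAt
    refine .of_isLittleO ?_
    -- Within `M` the normal part of `q - p` is negligible, so extending the derivative by zero to
    -- normal directions gives another derivative within `M`.
    have h2 : (fun q => q - p - tangentProj M p (q - p)) =o[𝓝[M] p] fun q => q - p := by
      obtain ⟨φ, ψ, a, h, -⟩ := hM.exists_chart hp
      have h3 : (fun q => φ (ψ q) - φ a - fderiv ℝ φ a (ψ q - a)) =o[𝓝[M] p] fun q => q - p :=
        (h.hasFDerivAt_base.isLittleO.comp_tendsto h.tendsto).trans_isBigO h.isBigO_inverse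
      have h4 := h3.sub (((tangentProj M p).isBigO_comp _ _).trans_isLittleO h3)
      refine h4.congr' ?_ EventuallyEq.rfl
      filter_upwards [h.right_inv] with q hq
      have h5 : tangentProj M p (fderiv ℝ φ a (ψ q - a)) = fderiv ℝ φ a (ψ q - a) :=
        Submodule.starProjection_eq_self_iff.2 (h.fderiv_mem_tangentSpace _)
      rw [hq, h.map_base, map_sub _ (q - p), h5]
      abel
    have h3 := h1.isLittleO.add
      (((fderivWithin ℝ (tangentProj M) M p).isBigO_comp _ _).trans_isLittleO h2)
    refine h3.congr_left fun q => ?_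
    rw [map_sub _ (q - p)]
    simp only [derivTangentProj, ContinuousLinearMap.comp_apply]
    abel
  · have hhalf : ∀ a, τ⁻¹ * Metric.infDist a M ≤ 1 / 2 → dist a (ξ a) ≤ τ / 2 := by
      intro a ha
      rw [← hξ, ← mul_le_mul_iff_right₀ (inv_pos.2 hτ)]
      refine ha.trans (le_of_eq ?_)
      field_simp
    exact hU.dist_nearest_le hcl hτ (hξM a) (hξM b) (hξ a).symm (hξ b).symm (hhalf a ha) (hhalf b hb)

/-- Expand `‖(q - p) + (p - z)‖² ≤ R²`. The strictly negative quadratic term is what later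
compensates the positive height. -/
theorem inner_le_of_mem_closedBall {E : Type*} [NormedAddCommGroup E] [InnerProductSpace ℝ E]
    {R : ℝ} {p q z : E} (hp : p ∈ Metric.sphere z R) (hq : q ∈ Metric.closedBall z R) :
    ⟪p - z, q - p⟫ ≤ -(‖q - p‖ ^ 2 / 2) := by
  rw [Metric.mem_closedBall, dist_eq_norm] at hq
  rw [mem_sphere_iff_norm] at hp
  have h1 := pow_le_pow_left₀ (norm_nonneg _) hq 2
  rw [← sub_add_sub_cancel q p z, norm_add_sq_real, hp, real_inner_comm] at h1
  linarith

theorem mem_normalCone_convexHull {p v : EuclideanSpace ℝ (Fin n)} :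
    v ∈ normalCone (convexHull ℝ M) p ↔ ∀ q ∈ M, ⟪v, q - p⟫ ≤ 0 := by
  refine ⟨fun h q hq => h q (subset_convexHull ℝ M hq), fun h => ?_⟩
  have hconv : Convex ℝ {q | ⟪v, q - p⟫ ≤ 0} := by
    have : {q : EuclideanSpace ℝ (Fin n) | ⟪v, q - p⟫ ≤ 0} = {q | innerSL ℝ v q ≤ ⟪v, p⟫} := by
      ext q
      simp [inner_sub_right]
    rw [this]
    exact convex_halfSpace_le (innerSL ℝ v).toLinearMap.isLinear _
  exact fun x hx => convexHull_min h hconv hx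

/-- A vector close to the unit ball can be normalized at the cost of doubling the distance. -/
theorem exists_smul_norm_le {E : Type*} [NormedAddCommGroup E] [NormedSpace ℝ E] {v w : E} {D : ℝ}
    (hv : ‖v‖ ≤ 1) (hD : ‖v - w‖ ≤ D) : ∃ c : ℝ, 0 ≤ c ∧ ‖c • w‖ ≤ 1 ∧ ‖v - c • w‖ ≤ 2 * D := by
  have hD0 := (norm_nonneg _).trans hD
  rcases le_or_gt ‖w‖ 1 with h | h
  · exact ⟨1, zero_le_one, by simpa using h, by rw [one_smul]; linarith⟩
  · have hw : 0 < ‖w‖ := by linarith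
    refine ⟨‖w‖⁻¹, by positivity, ?_, ?_⟩
    · rw [norm_smul, norm_inv, norm_norm, inv_mul_cancel₀ hw.ne']
    · have h1 : ‖w - ‖w‖⁻¹ • w‖ = ‖w‖ - 1 := by
        have : w - ‖w‖⁻¹ • w = (1 - ‖w‖⁻¹) • w := by module
        rw [this, norm_smul, Real.norm_of_nonneg (sub_nonneg.2 (inv_le_one_of_one_le₀ h.le)),
          sub_mul, inv_mul_cancel₀ hw.ne', one_mul]
      have h2 := norm_sub_norm_le w v
      rw [norm_sub_rev] at h2
      calc ‖v - ‖w‖⁻¹ • w‖ ≤ ‖v - w‖ + ‖w - ‖w‖⁻¹ • w‖ := norm_sub_le_norm_sub_add_norm_sub _ _ _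
        _ ≤ 2 * D := by rw [h1]; linarith

namespace ReachGeometry

variable {k Λ R : ℝ} {ξ : EuclideanSpace ℝ (Fin n) → EuclideanSpace ℝ (Fin n)}
  {x y : EuclideanSpace ℝ (Fin n)}

/-- The exposing ball makes `M` curve at least like `1 / R` in the direction of its centre, while
the reach allows at most `k`. A second point of `M` is needed for the comparison. -/
theorem one_le_mul_radius (H : ReachGeometry M k Λ ξ) (hM : IsC21Submanifold d M)
    (hR : IsExposed R M) (hx : x ∈ M) (hy : y ∈ M) (hne : x ≠ y) : 1 ≤ k * R := by
  obtain ⟨z, hz, hxz⟩ := hR x hx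
  have h1 : ∀ q ∈ M, ⟪x - z, q - x⟫ ≤ 0 := fun q hq =>
    (inner_le_of_mem_closedBall hxz (hz hq)).trans (by have := sq_nonneg ‖q - x‖; linarith)
  have h2 := hM.tangentProj_eq_zero_of_forall_inner_le hx h1
  have h3 := H.inner_le x hx (-(x - z)) (by rw [map_neg, h2, neg_zero]) y hy
  have h4 := inner_le_of_mem_closedBall hxz (hz hy)
  rw [inner_neg_left, norm_neg, mem_sphere_iff_norm.1 hxz] at h3
  have h5 : 0 < ‖y - x‖ ^ 2 := by
    have := norm_pos_iff.2 (sub_ne_zero.2 hne.symm)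
    positivity
  refine le_of_mul_le_mul_right (a := ‖y - x‖ ^ 2) ?_ h5
  linarith

/-- The height function of the normal part at `y` of an outward normal `v` at `x` is at most
quadratically positive on `M`. -/
theorem height_le (H : ReachGeometry M k Λ ξ) (hx : x ∈ M) (hy : y ∈ M)
    {v : EuclideanSpace ℝ (Fin n)} (hv : ‖v‖ ≤ 1) (hvx : tangentProj M x v = 0)
    (hmax : ∀ z ∈ M, ⟪v, z - x⟫ ≤ 0) (hxy : 4 * (k * ‖x - y‖) ≤ 1)
    {q : EuclideanSpace ℝ (Fin n)} (hq : q ∈ M) :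
    ⟪v - tangentProj M y v, q - y⟫ ≤ 264 * (Λ + k ^ 2) * ‖x - y‖ * ‖q - y‖ ^ 2 := by
  have hk := H.k_pos
  have hΛ := H.Λ_nonneg
  rcases le_or_gt (4 * (k * ‖q - y‖)) 1 with hqy | hqy
  · exact H.inner_sub_tangentProj_le hx hy hq hv hvx hmax hxy hqy
  -- Far from `y` no transport is needed: the height is at most `5 * k * ‖x - y‖ * ‖q - y‖`, and `1
  -- < 4 * (k * ‖q - y‖)` makes this quadratic in `‖q - y‖`.
  have hle : ‖x - y‖ ≤ ‖q - y‖ := by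
    by_contra! h
    have := mul_lt_mul_of_pos_left h hk
    linarith
  have h1 : ⟪v, x - y⟫ ≤ k * ‖x - y‖ * ‖q - y‖ := by
    have h2 := H.inner_le x hx (-v) (by rw [map_neg, hvx, neg_zero]) y hy
    rw [inner_neg_left, ← inner_neg_right, neg_sub, norm_neg, norm_sub_rev y x] at h2
    have h3 : k * ‖v‖ * ‖x - y‖ ^ 2 ≤ k * 1 * (‖x - y‖ * ‖q - y‖) := by
      rw [pow_two]
      gcongr
    have h4 : 0 ≤ k * ‖x - y‖ * ‖q - y‖ := by positivity
    linarith
  have h2 : -⟪tangentProj M y v, q - y⟫ ≤ 4 * k * ‖x - y‖ * ‖q - y‖ := by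
    have h3 := H.norm_tangentProj_le_of_normal hx hy
      (by rw [norm_sub_rev]; linarith [mul_nonneg hk.le (norm_nonneg (x - y))]) hvx
    rw [norm_sub_rev y x] at h3
    refine (neg_le_abs _).trans ((abs_real_inner_le_norm _ _).trans ?_)
    gcongr
    refine h3.trans ?_
    calc 4 * k * ‖x - y‖ * ‖v‖ ≤ 4 * k * ‖x - y‖ * 1 := by gcongr
      _ = _ := mul_one _
  have h3 : ⟪v - tangentProj M y v, q - y⟫ =
      ⟪v, q - x⟫ + ⟪v, x - y⟫ - ⟪tangentProj M y v, q - y⟫ := by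
    rw [inner_sub_left, ← inner_add_right, sub_add_sub_cancel]
  have h4 : k * ‖x - y‖ * ‖q - y‖ * 1 ≤ k * ‖x - y‖ * ‖q - y‖ * (4 * (k * ‖q - y‖)) := by
    gcongr
  have h5 : 0 ≤ Λ * ‖x - y‖ * ‖q - y‖ ^ 2 := by positivity
  have h6 : 0 ≤ k ^ 2 * ‖x - y‖ * ‖q - y‖ ^ 2 := by positivity
  rw [h3]
  nlinarith [hmax q hq]

/-- One half of the Hausdorff bound: take the normal part of `v` at `y`, correct it by the exposing
normal, then normalize. -/
theorem exists_mem_normalCone (H : ReachGeometry M k Λ ξ) (hM : IsC21Submanifold d M)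
    (hR0 : 0 < R) (hR : IsExposed R M) (hx : x ∈ M) (hy : y ∈ M) {v : EuclideanSpace ℝ (Fin n)}
    (hv : v ∈ normalCone (convexHull ℝ M) x ∩ Metric.closedBall 0 1) :
    ∃ w ∈ normalCone (convexHull ℝ M) y ∩ Metric.closedBall 0 1,
      dist v w ≤ 2000 * R * (Λ + k ^ 2) * ‖x - y‖ := by
  have hk := H.k_pos
  have hΛ := H.Λ_nonneg
  rcases eq_or_ne x y with rfl | hne
  · exact ⟨v, hv, by simp⟩
  have hkR := H.one_le_mul_radius hM hR hx hy hne
  have hmax := mem_normalCone_convexHull.1 hv.1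
  have hv1 : ‖v‖ ≤ 1 := mem_closedBall_zero_iff.1 hv.2
  have hvx := hM.tangentProj_eq_zero_of_forall_inner_le hx hmax
  set ε := ‖x - y‖ with hε
  have hε0 : 0 ≤ ε := norm_nonneg _
  have hkε : k * ε ≤ R * (Λ + k ^ 2) * ε := by
    have h1 : k * ε * 1 ≤ k * ε * (k * R) := by gcongr
    have h2 : 0 ≤ R * Λ * ε := by positivity
    linarith
  rcases lt_or_ge 1 (4 * (k * ε)) with hfar | hnear
  · refine ⟨0, ⟨mem_normalCone_convexHull.2 (by simp), by simp⟩, ?_⟩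
    rw [dist_zero_right]
    linarith
  obtain ⟨z, hz, hyz⟩ := hR y hy
  -- The coefficient is twice that of `height_le`, since the exposing ball yields only `‖q - y‖ ^ 2
  -- / 2`.
  set w := v - tangentProj M y v + (528 * (Λ + k ^ 2) * ε) • (y - z) with hw
  have hwy : ∀ q ∈ M, ⟪w, q - y⟫ ≤ 0 := by
    intro q hq
    have h1 := H.height_le hx hy hv1 hvx hmax hnear hq
    have h2 := inner_le_of_mem_closedBall hyz (hz hq)
    have h3 : 528 * (Λ + k ^ 2) * ε * ⟪y - z, q - y⟫ ≤
        528 * (Λ + k ^ 2) * ε * -(‖q - y‖ ^ 2 / 2) := by gcongr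
    rw [hw, inner_add_left, real_inner_smul_left]
    linarith
  -- The constant is `4 + 528`: the tangential part via `hkε` and the correction of length `528 * (Λ
  -- + k ^ 2) * ε * R`. Normalizing doubles it to 1064, below 2000.
  have hvw : ‖v - w‖ ≤ 532 * (R * (Λ + k ^ 2) * ε) := by
    have h1 : v - w = tangentProj M y v - (528 * (Λ + k ^ 2) * ε) • (y - z) := by
      rw [hw]; abel
    have h2 := H.norm_tangentProj_le_of_normal hx hy (by rw [norm_sub_rev]; linarith) hvx
    rw [norm_sub_rev y x, ← hε] at h2
    have h3 : 4 * k * ε * ‖v‖ ≤ 4 * k * ε * 1 := by gcongr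
    rw [h1]
    refine (norm_sub_le _ _).trans ?_
    rw [norm_smul, mem_sphere_iff_norm.1 hyz, Real.norm_of_nonneg (by positivity)]
    linarith
  obtain ⟨c, hc, hc1, hc2⟩ := exists_smul_norm_le hv1 hvw
  refine ⟨c • w, ⟨mem_normalCone_convexHull.2 fun q hq => ?_, mem_closedBall_zero_iff.2 hc1⟩, ?_⟩
  · rw [real_inner_smul_left]
    exact mul_nonpos_of_nonneg_of_nonpos hc (hwy q hq)
  · rw [dist_eq_norm]
    have : 0 ≤ R * (Λ + k ^ 2) * ε := by positivity
    linarith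

end ReachGeometry

end

end ExposedManifold

/-! ### The Hausdorff bound, by exchanging the roles of `x` and `y`. -/

theorem mainTheorem2 :
    ∃ C : ℝ, 0 < C ∧
      ∀ (n d : ℕ) (M : Set (EuclideanSpace ℝ (Fin n))) (τ R Λ : ℝ),
        0 < τ → 0 < R → 0 < Λ →
        IsClosed M →
        ExposedManifold.IsC21Submanifold d M →
        ENNReal.ofReal τ ≤ ExposedManifold.reach M →
        ExposedManifold.IsExposed R M →
        ExposedManifold.HasLipschitzSecondFundamentalForm Λ M →
        ∀ x ∈ M, ∀ y ∈ M,
          ExposedManifold.coneDist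
              (ExposedManifold.normalCone (convexHull ℝ M) x)
              (ExposedManifold.normalCone (convexHull ℝ M) y) ≤
            C * R * (Λ + τ⁻¹ ^ 2) * ‖x - y‖ := by
  refine ⟨2000, by norm_num, fun n d M τ R Λ hτ hR hΛ hcl hM hreach hexp hII x hx y hy => ?_⟩
  obtain ⟨ξ, H⟩ := hM.exists_reachGeometry hcl ⟨x, hx⟩ hτ hΛ.le hreach hII
  refine Metric.hausdorffDist_le_of_mem_dist (by positivity) (fun v hv => ?_) fun v hv => ?_
  · exact H.exists_mem_normalCone hM hR hexp hx hy hv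
  · rw [norm_sub_rev]
    exact H.exists_mem_normalCone hM hR hexp hy hx hv
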